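/- Let $m\ge 2$ be an integer and let $g:[0,2\pi]\to\mathbb R$ be continuous, three times continuously differentiable in some neighbourhood of $\frac{2\pi}{m}$, with $g''\left(\frac{2\pi}{m}\right)\ne 0$. For points $U_1,\dots,U_m$ of the unit circle $S^1$ let $0=\beta_0\le\beta_1\le\dots\le\beta_{m-1}<\beta_m=2\pi$, where $\beta_0,\dots,\beta_{m-1}$ are the counterclockwise angles in $[0,2\pi)$ from $U_1$ to $U_1,\dots,U_m$ arranged in nondecreasing order, and put $$f(U_1,\dots,U_m)=\sum_{i=1}^m g(\beta_i-\beta_{i-1}).$$ Suppose that $f$ attains its maximum over $(S^1)^m$ only when $U_1,\dots,U_m$ are (in some order) the vertices of a regular $m$-gon. Let $U_1,U_2,\dots$ be independent random points of $S^1$ with a common continuous density $p$ with respect to arc length, regarded as a continuous non-negative $2\pi$-periodic function of the polar angle, such that $$\int_0^{2\pi}\prod_{l=0}^{m-1}p\left(x+\tfrac{2\pi l}{m}\right)dx>0,$$ and let $$H_n=\max_{1\le i_1<\dots<i_m\le n}f(U_{i_1},\dots,U_{i_m})\qquad(n\ge m).$$ Then for every $t>0$ $$\lim_{n\to\infty}\mathbb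 P\left\{n^{\frac{2m}{m-1}}\left(m\,g\left(\tfrac{2\pi}{m}\right)-H_n\right)\le t\right\}=1-\exp\left(-\frac{t^{\frac{m-1}{2}}K}{m}\right),$$ where $$K=\frac{(2\pi)^{\frac{m-1}{2}}\int_0^{2\pi}\prod_{l=0}^{m-1}p\left(x+\frac{2\pi l}{m}\right)dx}{\left(-g''\left(\frac{2\pi}{m}\right)\right)^{\frac{m-1}{2}}\,\Gamma\left(\frac{m+1}{2}\right)\sqrt m}.$$ -/

import Mathlib

open MeasureTheory ProbabilityTheory Filter Topology

noncomputable section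

namespace CirclePolygon

/-- The unit circle carries its Borel `σ`-algebra. -/
instance instMeasurableSpaceCircle : MeasurableSpace Circle := borel Circle

instance instBorelSpaceCircle : BorelSpace Circle := ⟨rfl⟩

/-- The angle `∠ u O v`, measured counterclockwise from `u` to `v`, as a number in `[0, 2π)`. -/
def ccwAngle (u v : Circle) : ℝ :=
  toIcoMod Real.two_pi_pos 0 (Complex.arg ((v / u : Circle) : ℂ))

/-- The central angles of `U 0, …, U (m-1)`, measured from `U 0` (so that the angle of `U 0` itself
is `0`), arranged in nondecreasing order, with `2π` appended:
`0 = β₀ ≤ β₁ ≤ … ≤ β_{m-1} ≤ β_m = 2π`. -/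
def orderedAngles {m : ℕ} [NeZero m] (U : Fin m → Circle) : Fin (m + 1) → ℝ :=
  Fin.snoc (α := fun _ => ℝ)
    ((fun j => ccwAngle (U 0) (U j)) ∘ Tuple.sort (fun j => ccwAngle (U 0) (U j)))
    (2 * Real.pi)

/-- The kernel `f(U) = ∑ i, g (β_i - β_{i-1})`, the sum of `g` over the `m` consecutive arcs cut out
by the points `U`. -/
def arcKernel (g : ℝ → ℝ) {m : ℕ} [NeZero m] (U : Fin m → Circle) : ℝ :=
  ∑ i : Fin m, g (orderedAngles U i.succ - orderedAngles U i.castSucc)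

/-- `U 0, …, U (m-1)` are, in some order, the `m` vertices of a regular `m`-gon inscribed in the
unit circle. -/
def IsRegularPolygon {m : ℕ} (U : Fin m → Circle) : Prop :=
  ∃ (z : Circle) (σ : Equiv.Perm (Fin m)),
    ∀ j, U j = z * Circle.exp (2 * Real.pi * ((σ j : ℕ) : ℝ) / (m : ℝ))

/-- The law on the unit circle with density `p` with respect to arc length, where `p` is written as
a function of the polar angle. -/
def circleLaw (p : ℝ → ℝ) : Measure Circle :=
  ((volume.restrict (Set.Ico 0 (2 * Real.pi))).withDensity
    (fun x => ENNReal.ofReal (p x))).map Circle.exp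

/-- The `U`-max statistic of the first `n` terms of a sequence `u`: the maximum of
`f (u i₁, …, u i_m)` over all `i₁ < … < i_m` among the first `n` indices.  This is a maximum over
a finite set, nonempty as soon as `m ≤ n`. -/
def uMax {α : Type*} {m : ℕ} (f : (Fin m → α) → ℝ) (n : ℕ) (u : ℕ → α) : ℝ :=
  ⨆ s : Fin m ↪o Fin n, f (fun j => u (s j))

/-- `∫₀^{2π} ∏_{l=0}^{m-1} p (x + 2πl/m) dx`. -/
def regularOverlap (p : ℝ → ℝ) (m : ℕ) : ℝ :=
  ∫ x in (0 : ℝ)..(2 * Real.pi), ∏ l ∈ Finset.range m, p (x + 2 * Real.pi * (l : ℝ) / (m : ℝ))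

/-- The constant `K` of the limit law. -/
def limitConst (g p : ℝ → ℝ) (m : ℕ) : ℝ :=
  ((2 * Real.pi) ^ (((m : ℝ) - 1) / 2) * regularOverlap p m) /
    ((-(iteratedDeriv 2 g (2 * Real.pi / (m : ℝ)))) ^ (((m : ℝ) - 1) / 2) *
      Real.Gamma (((m : ℝ) + 1) / 2) * Real.sqrt (m : ℝ))

end CirclePolygon

end

/-! Write `m = k + 1` and let `a = 2π/m` be the side arc of the regular polygon. The event that the
scaled deficit is at most `t` says that some `m`-tuple of the sample has kernel within `ε²` of its
maximum, where `ε = √t · n^(-m/(m-1))`. Such tuples are rare and weakly dependent, so their number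
is asymptotically Poisson, and the limit is one minus the probability that there are none. This
needs three ingredients.

Poisson approximation. If `W` counts finitely many events with total mean `λ`, then `E[u^W] ·
exp(-λu)` equals `P(W = 0)` at `u = 0` and `exp(-λ)` at `u = 1`; its derivative is controlled by the
pairs of dependent events (`abs_measureReal_iInter_compl_sub_exp_le`). Here two tuples are dependent
only when they share an index.

Local asymptotics of one tuple. The kernel depends only on the `m` consecutive arcs, a point of a
compact simplex. The hypothesis on maximisers makes equal arcs the unique maximum there, with
`g''(a) < 0`, so a deficit of at most `ε²` forces every arc to be within `O(ε)` of `a`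
(`exists_sqrt_bound`). Integrating out the first point leaves an integral over the other `k` arcs;
rescaling by `ε` turns the region into an ellipsoid in the limit, and dominated convergence gives
`P(f ≥ max - ε²) ~ k! · K · ε^k` (`tendsto_measureReal_le_arcKernel_div`). With `C(n, m)` tuples the
mean number tends to `t^(k/2) K / m`.

Clustering is negligible. In a near-maximal tuple all the `m`-th powers of the points nearly
coincide, so given one point each other point lies in a set of probability `O(ε)`
(`exists_norm_pow_sub_pow_le`, `exists_circleLaw_near_le`). Two tuples using `j > m` indices
together and sharing one are thus both near-maximal with probability `O(ε^(j-1))`, and `n^j ε^(j-1)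
→ 0`. -/

noncomputable section

namespace CirclePolygon

/-! ### Poisson approximation through the generating function -/

section Poisson

variable {Ω ι : Type*}

/-- The number of events among `A i`, `i ∈ s`, that occur at `ω`. -/
def eventCount (A : ι → Set Ω) (s : Finset ι) (ω : Ω) : ℕ :=
  ∑ i ∈ s, (A i).indicator (fun _ => 1) ω

theorem measurable_eventCount [MeasurableSpace Ω] {A : ι → Set Ω} (hA : ∀ i, MeasurableSet
    (A i)) (s : Finset ι) :
    Measurable (eventCount A s) := by
  unfold eventCount
  exact Finset.measurable_fun_sum _ fun i _ => measurable_const.indicator (hA i)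

theorem eventCount_le [Fintype ι] (A : ι → Set Ω) (s : Finset ι) (ω : Ω) :
    eventCount A s ω ≤ Fintype.card ι := by
  calc eventCount A s ω ≤ ∑ i ∈ s, 1 := by
        refine Finset.sum_le_sum fun i _ => ?_
        by_cases h : ω ∈ A i <;> simp [h]
    _ ≤ Fintype.card ι := by simpa using Finset.card_le_univ s

/-- Bernoulli's inequality gives `1 - u^d ≤ d(1 - u) ≤ d`. It bounds the cost of removing `d` events
from the exponent of the generating function. -/
theorem abs_pow_sub_pow_add_le {u : ℝ} (h0 : 0 ≤ u) (h1 : u ≤ 1) (a d : ℕ) :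
    |u ^ a - u ^ (a + d)| ≤ d := by
  have hd : 1 - u ^ d ≤ d := by
    have := one_add_mul_le_pow (a := u - 1) (by linarith) d
    have h3 : (d : ℝ) * (1 - u) ≤ d := by
      have : (0 : ℝ) ≤ d := by positivity
      nlinarith
    simp only [add_sub_cancel] at this
    nlinarith
  have e : u ^ a - u ^ (a + d) = u ^ a * (1 - u ^ d) := by ring
  have ha1 : u ^ a ≤ 1 := pow_le_one₀ h0 h1
  have ha0 : 0 ≤ u ^ a := pow_nonneg h0 a
  have hd0 : 0 ≤ 1 - u ^ d := sub_nonneg.2 (pow_le_one₀ h0 h1)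
  rw [e, abs_of_nonneg (mul_nonneg ha0 hd0)]
  nlinarith

theorem norm_nat_mul_pow_le {R : ℝ} (hR : 1 ≤ R) {u : ℝ} (hu : |u| ≤ R) {w N : ℕ} (hw : w ≤ N)
    (e : ℕ) (he : e ≤ N) : ‖(w : ℝ) * u ^ e‖ ≤ N * R ^ N := by
  rw [norm_mul, norm_pow, Real.norm_natCast, Real.norm_eq_abs]
  gcongr
  exact (pow_le_pow_left₀ (abs_nonneg _) hu e).trans (pow_le_pow_right₀ hR he)

variable [MeasurableSpace Ω] (P : Measure Ω)

theorem integrable_pow_eventCount [IsProbabilityMeasure P] {A : ι → Set Ω}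
    (hA : ∀ i, MeasurableSet (A i)) (s : Finset ι)
    {u : ℝ} (h0 : 0 ≤ u) (h1 : u ≤ 1) : Integrable (fun ω => u ^ eventCount A s ω) P := by
  refine Integrable.of_bound (C := 1) ?_ (ae_of_all _ fun ω => ?_)
  · exact ((measurable_of_countable (fun n : ℕ => u ^ n)).comp
      (measurable_eventCount hA s)).aestronglyMeasurable
  · rw [Real.norm_eq_abs, abs_of_nonneg (pow_nonneg h0 _)]
    exact pow_le_one₀ h0 h1

theorem hasDerivAt_integral_pow_eventCount [Fintype ι] [IsProbabilityMeasure P] {A : ι → Set Ω}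
    (hA : ∀ i, MeasurableSet (A i))
    (s : Finset ι) (u : ℝ) :
    HasDerivAt (fun v : ℝ => ∫ ω, v ^ eventCount A s ω ∂P)
      (∫ ω, (eventCount A s ω : ℝ) * u ^ (eventCount A s ω - 1) ∂P) u := by
  have hm := measurable_eventCount hA s
  have hmeas : ∀ F : ℕ → ℝ, AEStronglyMeasurable (fun ω => F (eventCount A s ω)) P := fun F =>
    ((measurable_of_countable F).comp hm).aestronglyMeasurable
  have key := hasDerivAt_integral_of_dominated_loc_of_deriv_le (μ := P)
    (F := fun v ω => v ^ eventCount A s ω)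
    (F' := fun v ω => (eventCount A s ω : ℝ) * v ^ (eventCount A s ω - 1)) (x₀ := u)
    (s := Metric.ball u 1)
    (bound := fun _ => (Fintype.card ι : ℝ) * (|u| + 1) ^ Fintype.card ι)
    (Metric.ball_mem_nhds u one_pos)
    (Eventually.of_forall fun v => hmeas (fun n => v ^ n)) ?_
    (hmeas (fun n => (n : ℝ) * u ^ (n - 1))) ?_ (integrable_const _) ?_
  · exact key.2
  · refine Integrable.of_bound (C := (|u| + 1) ^ Fintype.card ι) (hmeas (fun n => u ^ n))
      (ae_of_all _ fun ω => ?_)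
    rw [norm_pow, Real.norm_eq_abs]
    exact (pow_le_pow_left₀ (abs_nonneg _) (by linarith) _).trans
      (pow_le_pow_right₀ (by linarith [abs_nonneg u]) (eventCount_le A s ω))
  · refine ae_of_all _ fun ω v hv => ?_
    refine norm_nat_mul_pow_le (by linarith [abs_nonneg u]) ?_ (eventCount_le A s ω) _
      ((Nat.sub_le _ _).trans (eventCount_le A s ω))
    rw [Metric.mem_ball, Real.dist_eq] at hv
    have := abs_sub_abs_le_abs_sub v u
    linarith
  · refine ae_of_all _ fun ω v _ => ?_
    simpa using hasDerivAt_pow (eventCount A s ω) v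

theorem integral_indicator_mul_eq_measureReal {B : Set Ω} (hB : MeasurableSet B) (C : Set Ω)
    (hC : MeasurableSet C) :
    ∫ ω, B.indicator (fun _ => (1 : ℝ)) ω * C.indicator (fun _ => (1 : ℝ)) ω ∂P
      = P.real (B ∩ C) := by
  have : (fun ω => B.indicator (fun _ => (1 : ℝ)) ω * C.indicator (fun _ => (1 : ℝ)) ω)
      = (B ∩ C).indicator (fun _ => (1 : ℝ)) := by
    ext ω
    by_cases h1 : ω ∈ B <;> by_cases h2 : ω ∈ C <;> simp [h1, h2]
  rw [this, integral_indicator_const _ (hB.inter hC)]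
  simp

theorem integral_indicator_one_eq {B : Set Ω} (hB : MeasurableSet B) :
    ∫ ω, B.indicator (fun _ => (1 : ℝ)) ω ∂P = P.real B := by
  rw [integral_indicator_const _ hB]; simp

variable [Fintype ι] [DecidableEq ι] [IsProbabilityMeasure P]

/-- On `A i` the exponent `W - 1` is the count outside `N` plus the count over `N.erase i`. Dropping
the latter costs at most `P(A i ∩ A j)` for each `j`; the remaining power is independent of `A i`,
so the integral factors; putting the events of `N` back into the second factor costs `P(A i) P(A j)`
each. -/
theorem abs_integral_indicator_pow_sub_le {A : ι → Set Ω} (hA : ∀ i, MeasurableSet (A i))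
    (i : ι) (N : Finset ι) (hN : i ∈ N)
    (hind : IndepFun ((A i).indicator fun _ => (1 : ℝ)) (eventCount A Nᶜ) P)
    {u : ℝ} (h0 : 0 ≤ u) (h1 : u ≤ 1) :
    |∫ ω, (A i).indicator (fun _ => (1 : ℝ)) ω * u ^ (eventCount A Finset.univ ω - 1) ∂P
        - P.real (A i) * ∫ ω, u ^ eventCount A Finset.univ ω ∂P|
      ≤ ∑ j ∈ N, P.real (A i) * P.real (A j) + ∑ j ∈ N.erase i, P.real (A i ∩ A j) := by
  set I : ι → Ω → ℝ := fun j => (A j).indicator fun _ => (1 : ℝ) with hI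
  have hI0 : ∀ j ω, 0 ≤ I j ω := fun j ω => Set.indicator_nonneg (fun _ _ => zero_le_one) ω
  have hI1 : ∀ j ω, I j ω ≤ 1 := fun j ω => by
    by_cases h : ω ∈ A j <;> simp [hI, h]
  have hImeas : ∀ j, Measurable (I j) := fun j => measurable_const.indicator (hA j)
  have hcast : ∀ (s : Finset ι) ω, (eventCount A s ω : ℝ) = ∑ j ∈ s, I j ω := by
    intro s ω
    unfold eventCount
    push_cast
    refine Finset.sum_congr rfl fun j _ => ?_
    by_cases h : ω ∈ A j <;> simp [hI, h]
  have hsplit : ∀ ω, eventCount A Finset.univ ω = eventCount A Nᶜ ω + eventCount A N ω := by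
    intro ω
    unfold eventCount
    rw [add_comm, Finset.sum_add_sum_compl]
  have hsplit' : ∀ ω, ω ∈ A i →
      eventCount A Finset.univ ω - 1 = eventCount A Nᶜ ω + eventCount A (N.erase i) ω := by
    intro ω hω
    rw [hsplit ω]
    have : eventCount A N ω = 1 + eventCount A (N.erase i) ω := by
      unfold eventCount
      rw [← Finset.add_sum_erase N _ hN]
      simp [hω]
    omega
  have hpm : ∀ F : ℕ → ℕ, ∀ s, Measurable fun ω => u ^ F (eventCount A s ω) := fun F s =>
    (measurable_of_countable (fun n : ℕ => u ^ F n)).comp (measurable_eventCount hA s)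
  have hpow0 : ∀ n : ℕ, 0 ≤ u ^ n := fun n => pow_nonneg h0 n
  have hpow1 : ∀ n : ℕ, u ^ n ≤ 1 := fun n => pow_le_one₀ h0 h1
  have hint1 : Integrable (fun ω => I i ω * u ^ (eventCount A Finset.univ ω - 1)) P := by
    refine Integrable.of_bound (C := 1)
      ((hImeas i).mul (hpm (fun n => n - 1) _)).aestronglyMeasurable (ae_of_all _ fun ω => ?_)
    rw [Real.norm_eq_abs, abs_of_nonneg (mul_nonneg (hI0 _ _) (hpow0 _))]
    exact mul_le_one₀ (hI1 _ _) (hpow0 _) (hpow1 _)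
  have hint2 : Integrable (fun ω => I i ω * u ^ (eventCount A Nᶜ ω)) P := by
    refine Integrable.of_bound (C := 1)
      ((hImeas i).mul (hpm (fun n => n) _)).aestronglyMeasurable (ae_of_all _ fun ω => ?_)
    rw [Real.norm_eq_abs, abs_of_nonneg (mul_nonneg (hI0 _ _) (hpow0 _))]
    exact mul_le_one₀ (hI1 _ _) (hpow0 _) (hpow1 _)
  have hintI : ∀ j, Integrable (I j) P := fun j => (integrable_const 1).indicator (hA j)
  have hintII : ∀ j, Integrable (fun ω => I i ω * I j ω) P := fun j => by
    refine Integrable.of_bound (C := 1)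
      ((hImeas i).mul (hImeas j)).aestronglyMeasurable (ae_of_all _ fun ω => ?_)
    rw [Real.norm_eq_abs, abs_of_nonneg (mul_nonneg (hI0 _ _) (hI0 _ _))]
    exact mul_le_one₀ (hI1 _ _) (hI0 _ _) (hI1 _ _)
  have hindep : ∫ ω, I i ω * u ^ (eventCount A Nᶜ ω) ∂P
      = P.real (A i) * ∫ ω, u ^ (eventCount A Nᶜ ω) ∂P := by
    have h := (hind.comp (φ := id) (ψ := fun n : ℕ => u ^ n) measurable_id
      (measurable_of_countable _)).integral_fun_mul_eq_mul_integral
      (hImeas i).aestronglyMeasurable (hpm (fun n => n) _).aestronglyMeasurable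
    simp only [Function.comp_apply, id] at h
    rw [h]
    congr 1
    exact integral_indicator_one_eq P (hA i)
  have e1 : |∫ ω, I i ω * u ^ (eventCount A Finset.univ ω - 1) ∂P
      - ∫ ω, I i ω * u ^ (eventCount A Nᶜ ω) ∂P| ≤ ∑ j ∈ N.erase i, P.real (A i ∩ A j) := by
    rw [← integral_sub hint1 hint2]
    refine abs_integral_le_integral_abs.trans ?_
    have : ∑ j ∈ N.erase i, P.real (A i ∩ A j) = ∫ ω, ∑ j ∈ N.erase i, I i ω * I j ω ∂P := by
      rw [integral_finsetSum _ fun j _ => hintII j]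
      exact Finset.sum_congr rfl fun j _ =>
        (integral_indicator_mul_eq_measureReal P (hA i) _ (hA j)).symm
    rw [this]
    refine integral_mono (hint1.sub hint2).abs (integrable_finsetSum _ fun j _ => hintII j) ?_
    intro ω
    simp only
    rw [← Finset.mul_sum, ← hcast, ← mul_sub, abs_mul, abs_of_nonneg (hI0 _ _)]
    by_cases hω : ω ∈ A i
    · refine mul_le_mul_of_nonneg_left ?_ (hI0 _ _)
      rw [hsplit' ω hω, abs_sub_comm]
      exact abs_pow_sub_pow_add_le h0 h1 _ _
    · simp [hI, hω]
  have hint3 := integrable_pow_eventCount P hA Nᶜ h0 h1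
  have hint4 := integrable_pow_eventCount P hA Finset.univ h0 h1
  have e2 : |∫ ω, u ^ (eventCount A Nᶜ ω) ∂P - ∫ ω, u ^ (eventCount A Finset.univ ω) ∂P|
      ≤ ∑ j ∈ N, P.real (A j) := by
    rw [← integral_sub hint3 hint4]
    refine abs_integral_le_integral_abs.trans ?_
    have : ∑ j ∈ N, P.real (A j) = ∫ ω, ∑ j ∈ N, I j ω ∂P := by
      rw [integral_finsetSum _ fun j _ => hintI j]
      exact Finset.sum_congr rfl fun j _ => (integral_indicator_one_eq P (hA j)).symm
    rw [this]
    refine integral_mono (hint3.sub hint4).abs (integrable_finsetSum _ fun j _ => hintI j) ?_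
    intro ω
    simp only
    rw [← hcast, hsplit ω]
    exact abs_pow_sub_pow_add_le h0 h1 _ _
  have e3 : |P.real (A i) * ∫ ω, u ^ (eventCount A Nᶜ ω) ∂P
      - P.real (A i) * ∫ ω, u ^ (eventCount A Finset.univ ω) ∂P|
      ≤ ∑ j ∈ N, P.real (A i) * P.real (A j) := by
    rw [← mul_sub, abs_mul, abs_of_nonneg measureReal_nonneg, ← Finset.mul_sum]
    exact mul_le_mul_of_nonneg_left e2 measureReal_nonneg
  rw [hindep] at e1
  calc _ ≤ _ := abs_sub_le _ (P.real (A i) * ∫ ω, u ^ (eventCount A Nᶜ ω) ∂P) _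
    _ ≤ _ := by rw [add_comm]; exact add_le_add e3 e1

/-- Poisson approximation for the probability that none of finitely many weakly dependent events
occurs. -/
theorem abs_measureReal_iInter_compl_sub_exp_le {A : ι → Set Ω} (hA : ∀ i, MeasurableSet (A i))
    (N : ι → Finset ι) (hN : ∀ i, i ∈ N i)
    (hind : ∀ i, IndepFun ((A i).indicator fun _ => (1 : ℝ)) (eventCount A (N i)ᶜ) P) :
    |P.real (⋂ i, (A i)ᶜ) - Real.exp (-∑ i, P.real (A i))|
      ≤ ∑ i, (∑ j ∈ N i, P.real (A i) * P.real (A j)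
          + ∑ j ∈ (N i).erase i, P.real (A i ∩ A j)) := by
  set lam := ∑ i, P.real (A i) with hlam
  set W := eventCount A Finset.univ with hW
  set D : ℝ → ℝ := fun u => ∫ ω, (W ω : ℝ) * u ^ (W ω - 1) ∂P with hD
  -- This function interpolates between the two quantities: at `0` the convention `0 ^ 0 = 1` makes
  -- `u ^ W` the indicator of `W = 0`, and at `1` only the exponential remains. For an exactly
  -- Poisson `W` it would be constant.
  set psi : ℝ → ℝ := fun u => (∫ ω, u ^ W ω ∂P) * Real.exp (-lam * u) with hpsi
  have hderiv : ∀ u, HasDerivAt psi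
      (D u * Real.exp (-lam * u) + (∫ ω, u ^ W ω ∂P) * (Real.exp (-lam * u) * -lam)) u := by
    intro u
    refine (hasDerivAt_integral_pow_eventCount P hA Finset.univ u).mul ?_
    have := ((hasDerivAt_id u).const_mul (-lam)).exp
    simpa using this
  have hDeq : ∀ u : ℝ, 0 ≤ u → u ≤ 1 → D u = ∑ i, ∫ ω,
      (A i).indicator (fun _ => (1 : ℝ)) ω * u ^ (eventCount A Finset.univ ω - 1) ∂P := by
    intro u h0 h1
    rw [← integral_finsetSum]
    · refine integral_congr_ae (ae_of_all _ fun ω => ?_)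
      simp only [← Finset.sum_mul]
      congr 1
      simp only [hW, eventCount]
      push_cast
      refine Finset.sum_congr rfl fun j _ => ?_
      by_cases h : ω ∈ A j <;> simp [h]
    · intro i _
      refine Integrable.of_bound (C := 1) ((measurable_const.indicator (hA i)).mul
        ((measurable_of_countable (fun n : ℕ => u ^ (n - 1))).comp
          (measurable_eventCount hA _))).aestronglyMeasurable (ae_of_all _ fun ω => ?_)
      rw [Real.norm_eq_abs, abs_of_nonneg
        (mul_nonneg (Set.indicator_nonneg (fun _ _ => zero_le_one) _) (pow_nonneg h0 _))]
      refine mul_le_one₀ ?_ (pow_nonneg h0 _) (pow_le_one₀ h0 h1)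
      by_cases h : ω ∈ A i <;> simp [h]
  have hbound := norm_image_sub_le_of_norm_deriv_le_segment_01' (f := psi)
    (fun u _ => (hderiv u).hasDerivWithinAt)
    (C := ∑ i, (∑ j ∈ N i, P.real (A i) * P.real (A j)
          + ∑ j ∈ (N i).erase i, P.real (A i ∩ A j))) ?_
  · have h1 : psi 1 = Real.exp (-lam) := by simp [hpsi]
    have h0 : psi 0 = P.real (⋂ i, (A i)ᶜ) := by
      have hset : MeasurableSet (⋂ i, (A i)ᶜ) := MeasurableSet.iInter fun i => (hA i).compl
      rw [← integral_indicator_one_eq P hset]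
      simp only [hpsi, mul_zero, Real.exp_zero, mul_one]
      refine integral_congr_ae (ae_of_all _ fun ω => ?_)
      by_cases h : ω ∈ ⋂ i, (A i)ᶜ
      · have : W ω = 0 := by
          simp only [hW, eventCount, Finset.sum_eq_zero_iff]
          intro i _
          have : ω ∉ A i := by simpa using Set.mem_iInter.1 h i
          simp [this]
        simp [h, this]
      · have : W ω ≠ 0 := by
          simp only [hW, eventCount, ne_eq, Finset.sum_eq_zero_iff]
          intro hcon
          refine h (Set.mem_iInter.2 fun i hi => ?_)
          simpa [hi] using hcon i (Finset.mem_univ i)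
        simp [h, this]
    rw [← h0, ← h1, abs_sub_comm]
    simpa [Real.norm_eq_abs] using hbound
  · intro u hu
    have h0 := hu.1
    have h1 := hu.2.le
    have e : D u * Real.exp (-lam * u) + (∫ ω, u ^ W ω ∂P) * (Real.exp (-lam * u) * -lam)
        = Real.exp (-lam * u) * (D u - lam * ∫ ω, u ^ W ω ∂P) := by ring
    rw [e, Real.norm_eq_abs, abs_mul, abs_of_pos (Real.exp_pos _)]
    have hexp : Real.exp (-lam * u) ≤ 1 := by
      rw [Real.exp_le_one_iff]
      have : 0 ≤ lam := Finset.sum_nonneg fun i _ => measureReal_nonneg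
      nlinarith
    refine (mul_le_of_le_one_left (abs_nonneg _) hexp).trans ?_
    rw [hDeq u h0 h1, hlam, Finset.sum_mul, ← Finset.sum_sub_distrib]
    refine (Finset.abs_sum_le_sum_abs _ _).trans (Finset.sum_le_sum fun i _ => ?_)
    exact abs_integral_indicator_pow_sub_le P hA i (N i) (hN i) (hind i) h0 h1

end Poisson

/-! ### Consecutive arcs as points of a simplex -/

section Gaps

theorem ccwAngle_mem_Ico (u v : Circle) : ccwAngle u v ∈ Set.Ico 0 (2 * Real.pi) := by
  simpa [ccwAngle] using toIcoMod_mem_Ico Real.two_pi_pos 0 (Complex.arg ((v / u : Circle) : ℂ))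

theorem exp_ccwAngle (u v : Circle) : Circle.exp (ccwAngle u v) = v / u := by
  unfold ccwAngle
  rw [← self_sub_toIcoDiv_zsmul, Circle.exp_sub, Circle.exp_zsmul, Circle.exp_arg]
  simp

theorem ccwAngle_eq_of_exp_eq {u v : Circle} {x : ℝ} (hx : x ∈ Set.Ico 0 (2 * Real.pi))
    (h : Circle.exp x = v / u) : ccwAngle u v = x :=
  Circle.exp_injOn_Ico (by simp) (ccwAngle_mem_Ico u v) hx ((exp_ccwAngle u v).trans h.symm)

theorem ccwAngle_self (u : Circle) : ccwAngle u u = 0 :=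
  ccwAngle_eq_of_exp_eq ⟨le_rfl, Real.two_pi_pos⟩ (by simp)

variable {m k : ℕ}

/-- The central angles measured from the first point. -/
def baseAngles [NeZero m] (U : Fin m → Circle) : Fin m → ℝ := fun j => ccwAngle (U 0) (U j)

theorem baseAngles_mem_Ico [NeZero m] (U : Fin m → Circle) (j : Fin m) :
    baseAngles U j ∈ Set.Ico 0 (2 * Real.pi) := ccwAngle_mem_Ico _ _

theorem orderedAngles_eq_snoc [NeZero m] (U : Fin m → Circle) :
    orderedAngles U = Fin.snoc (α := fun _ => ℝ) (baseAngles U ∘ Tuple.sort (baseAngles U))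
      (2 * Real.pi) := rfl

theorem orderedAngles_eq_of_monotone [NeZero m] {U : Fin m → Circle} (σ : Equiv.Perm (Fin m))
    (h : Monotone (baseAngles U ∘ σ)) :
    orderedAngles U = Fin.snoc (α := fun _ => ℝ) (baseAngles U ∘ σ) (2 * Real.pi) := by
  rw [orderedAngles_eq_snoc, Tuple.comp_sort_eq_comp_iff_monotone.2 h]

/-- The consecutive arcs cut out by the points `U`. -/
def gaps [NeZero m] (U : Fin m → Circle) (i : Fin m) : ℝ :=
  orderedAngles U i.succ - orderedAngles U i.castSucc

/-- The sum of `g` over a family of arcs. -/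
def gapSum (g : ℝ → ℝ) (s : Fin m → ℝ) : ℝ := ∑ i, g (s i)

theorem arcKernel_eq_gapSum (g : ℝ → ℝ) [NeZero m] (U : Fin m → Circle) :
    arcKernel g U = gapSum g (gaps U) := rfl

/-- The simplex of all families of nonnegative arcs of total length `2π`. -/
def gapSimplex (m : ℕ) : Set (Fin m → ℝ) := {s | (∀ i, 0 ≤ s i) ∧ ∑ i, s i = 2 * Real.pi}

theorem le_two_pi_of_mem_gapSimplex {s : Fin m → ℝ} (hs : s ∈ gapSimplex m) (i : Fin m) :
    s i ≤ 2 * Real.pi := by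
  rw [← hs.2]
  exact Finset.single_le_sum (fun j _ => hs.1 j) (Finset.mem_univ i)

theorem mem_Icc_of_mem_gapSimplex {s : Fin m → ℝ} (hs : s ∈ gapSimplex m) (i : Fin m) :
    s i ∈ Set.Icc 0 (2 * Real.pi) := ⟨hs.1 i, le_two_pi_of_mem_gapSimplex hs i⟩

theorem isCompact_gapSimplex (m : ℕ) : IsCompact (gapSimplex m) := by
  refine (isCompact_univ_pi fun _ : Fin m =>
    isCompact_Icc (a := (0 : ℝ)) (b := 2 * Real.pi)).of_isClosed_subset ?_ ?_
  · have h1 : IsClosed {s : Fin m → ℝ | ∀ i, 0 ≤ s i} := by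
      simp only [Set.ofPred_forall]
      exact isClosed_iInter fun i => isClosed_le continuous_const (continuous_apply i)
    have h2 : IsClosed {s : Fin m → ℝ | ∑ i, s i = 2 * Real.pi} :=
      isClosed_eq (by fun_prop) continuous_const
    exact h1.inter h2
  · exact fun s hs i _ => mem_Icc_of_mem_gapSimplex hs i

theorem continuousOn_gapSum {g : ℝ → ℝ} (hg : ContinuousOn g (Set.Icc 0 (2 * Real.pi))) :
    ContinuousOn (gapSum g) (gapSimplex m) := by
  unfold gapSum
  refine continuousOn_finsetSum _ fun i _ => ?_
  exact hg.comp (continuous_apply i).continuousOn fun s hs => mem_Icc_of_mem_gapSimplex hs i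

theorem sum_succ_sub_castSucc (f : Fin (m + 1) → ℝ) :
    ∑ i : Fin m, (f i.succ - f i.castSucc) = f (Fin.last m) - f 0 := by
  rw [Finset.sum_sub_distrib]
  have h1 := Fin.sum_univ_succ f
  have h2 := Fin.sum_univ_castSucc f
  linarith

theorem gaps_eq_snoc_of_monotone {U : Fin (k + 1) → Circle} (σ : Equiv.Perm (Fin (k + 1)))
    (h : Monotone (baseAngles U ∘ σ)) :
    gaps U = Fin.snoc (α := fun _ => ℝ)
      (fun j : Fin k => baseAngles U (σ j.succ) - baseAngles U (σ j.castSucc))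
      (2 * Real.pi - baseAngles U (σ (Fin.last k))) := by
  funext i
  unfold gaps
  rw [orderedAngles_eq_of_monotone σ h]
  refine Fin.lastCases ?_ (fun j => ?_) i
  · rw [Fin.succ_last, Fin.snoc_last, Fin.snoc_castSucc, Fin.snoc_last]
    rfl
  · rw [Fin.succ_castSucc, Fin.snoc_castSucc, Fin.snoc_castSucc, Fin.snoc_castSucc]
    rfl

theorem orderedAngles_zero (U : Fin (k + 1) → Circle) : orderedAngles U 0 = 0 := by
  set x := baseAngles U with hx
  have hmono := Tuple.monotone_sort x
  have h0 : x 0 = 0 := ccwAngle_self _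
  have : orderedAngles U 0 = x (Tuple.sort x 0) := by
    rw [orderedAngles_eq_snoc, ← Fin.castSucc_zero, Fin.snoc_castSucc]
    rfl
  rw [this]
  refine le_antisymm ?_ (baseAngles_mem_Ico U _).1
  have := hmono (Fin.zero_le ((Tuple.sort x).symm 0))
  simpa [h0] using this

theorem orderedAngles_last (U : Fin (k + 1) → Circle) :
    orderedAngles U (Fin.last (k + 1)) = 2 * Real.pi := by
  rw [orderedAngles_eq_snoc, Fin.snoc_last]

theorem gaps_mem_gapSimplex (U : Fin (k + 1) → Circle) : gaps U ∈ gapSimplex (k + 1) := by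
  constructor
  · intro i
    rw [gaps_eq_snoc_of_monotone _ (Tuple.monotone_sort (baseAngles U))]
    refine Fin.lastCases ?_ (fun j => ?_) i
    · rw [Fin.snoc_last]
      exact sub_nonneg.2 (baseAngles_mem_Ico U _).2.le
    · rw [Fin.snoc_castSucc]
      exact sub_nonneg.2 (Tuple.monotone_sort (baseAngles U) (Fin.castSucc_le_succ j))
  · unfold gaps
    rw [sum_succ_sub_castSucc, orderedAngles_zero, orderedAngles_last, sub_zero]

theorem partialSum_last (w : Fin k → ℝ) : Fin.partialSum w (Fin.last k) = ∑ j, w j := by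
  have h := sum_succ_sub_castSucc (Fin.partialSum w)
  simp only [Fin.partialSum_succ, Fin.partialSum_zero, add_sub_cancel_left, sub_zero] at h
  exact h.symm

theorem monotone_partialSum {w : Fin k → ℝ} (hw : ∀ j, 0 ≤ w j) :
    Monotone (Fin.partialSum w) := by
  rw [Fin.monotone_iff_le_succ]
  intro i
  rw [Fin.partialSum_succ]
  linarith [hw i]

theorem gaps_eq_snoc_of_partialSum {U : Fin (k + 1) → Circle} (σ : Equiv.Perm (Fin (k + 1)))
    {w : Fin k → ℝ} (hw : ∀ j, 0 ≤ w j) (h : baseAngles U ∘ σ = Fin.partialSum w) :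
    gaps U = Fin.snoc (α := fun _ => ℝ) w (2 * Real.pi - ∑ j, w j) := by
  have h' : ∀ i, baseAngles U (σ i) = Fin.partialSum w i := fun i => congrFun h i
  rw [gaps_eq_snoc_of_monotone σ (h ▸ monotone_partialSum hw)]
  simp only [h', partialSum_last, Fin.partialSum_succ, add_sub_cancel_left]

theorem ccwAngle_exp_exp {x y : ℝ} (h : y - x ∈ Set.Ico 0 (2 * Real.pi)) :
    ccwAngle (Circle.exp x) (Circle.exp y) = y - x :=
  ccwAngle_eq_of_exp_eq h (Circle.exp_sub y x)

/-- The points are placed at the partial sums of the arcs. Angles live in `[0, 2π)`, so the closing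
arc of a configuration is never zero; hence the condition on the last arc. -/
theorem exists_gaps_eq {s : Fin (k + 1) → ℝ} (hs : s ∈ gapSimplex (k + 1))
    (hlast : 0 < s (Fin.last k)) : ∃ V : Fin (k + 1) → Circle, gaps V = s := by
  set w : Fin k → ℝ := fun j => s j.castSucc with hw
  have hw0 : ∀ j, 0 ≤ w j := fun j => hs.1 _
  have hsum : ∑ j, w j + s (Fin.last k) = 2 * Real.pi := by
    rw [← hs.2, Fin.sum_univ_castSucc]
  refine ⟨fun j => Circle.exp (Fin.partialSum w j), ?_⟩
  rw [gaps_eq_snoc_of_partialSum (w := w) (Equiv.refl _) hw0]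
  · funext i
    refine Fin.lastCases ?_ (fun j => ?_) i
    · rw [Fin.snoc_last]; linarith
    · rw [Fin.snoc_castSucc]
  · funext i
    have h0 := monotone_partialSum hw0 (Fin.zero_le i)
    have h1 := monotone_partialSum hw0 (Fin.le_last i)
    rw [partialSum_last] at h1
    rw [Fin.partialSum_zero] at h0
    simp only [baseAngles, Function.comp_apply, Equiv.refl_apply]
    rw [ccwAngle_exp_exp] <;> rw [Fin.partialSum_zero, sub_zero]
    exact ⟨h0, by linarith⟩

theorem partialSum_const (a : ℝ) (i : Fin (k + 1)) :
    Fin.partialSum (fun _ : Fin k => a) i = (i : ℕ) * a := by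
  refine Fin.induction ?_ (fun j hj => ?_) i
  · simp
  · rw [Fin.partialSum_succ, hj]
    simp
    ring

theorem IsRegularPolygon.gaps_eq {V : Fin (k + 1) → Circle} (hV : IsRegularPolygon V)
    (i : Fin (k + 1)) : gaps V i = 2 * Real.pi / ((k + 1 : ℕ) : ℝ) := by
  obtain ⟨z, σ, h⟩ := hV
  set a := 2 * Real.pi / ((k + 1 : ℕ) : ℝ) with ha
  have hpi := Real.two_pi_pos
  have ha0 : 0 < a := by positivity
  have hma : ((k + 1 : ℕ) : ℝ) * a = 2 * Real.pi := by
    rw [ha]; field_simp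
  -- Angles are measured from `V 0`, which is the vertex numbered `σ 0`; subtracting `σ 0` modulo `k
  -- + 1` renumbers the vertices from there.
  set τ : Equiv.Perm (Fin (k + 1)) := σ.trans (Equiv.subRight (σ 0)) with hτ
  have hτ' : ∀ j, τ j = σ j - σ 0 := fun j => rfl
  have hangle : ∀ j, baseAngles V j = (τ j : ℕ) * a := by
    intro j
    refine ccwAngle_eq_of_exp_eq ⟨by positivity, ?_⟩ ?_
    · rw [← hma]
      exact mul_lt_mul_of_pos_right (by exact_mod_cast (τ j).2) ha0
    · rw [h j, h 0, mul_div_mul_left_eq_div, ← Circle.exp_sub, hτ', Circle.exp_eq_exp]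
      rcases le_total (σ 0) (σ j) with hle | hle
      · refine ⟨0, ?_⟩
        rw [Fin.sub_val_of_le hle, Nat.cast_sub (by exact_mod_cast hle), ha]
        simp only [Int.cast_zero, zero_mul, add_zero]
        ring
      · rcases hle.eq_or_lt with heq | hlt
        · refine ⟨0, ?_⟩
          simp [heq]
        -- The subtraction in `Fin (k + 1)` wraps around here, which adds one full turn to the
        -- angle.
        · refine ⟨1, ?_⟩
          have hv : ((σ j - σ 0 : Fin (k + 1)) : ℕ) = k + 1 - (σ 0 : ℕ) + (σ j : ℕ) := by
            have h2 : (σ j : ℕ) < (σ 0 : ℕ) := hlt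
            rw [Fin.sub_def]
            simp only
            rw [Nat.mod_eq_of_lt (by omega)]
          rw [hv, Nat.cast_add, Nat.cast_sub (by omega), add_mul, sub_mul, hma, ha]
          push_cast
          ring
  rw [gaps_eq_snoc_of_partialSum (w := fun _ => a) τ.symm fun _ => ha0.le]
  · refine Fin.lastCases ?_ (fun j => ?_) i
    · rw [Fin.snoc_last, ← hma]
      simp
      ring
    · rw [Fin.snoc_castSucc]
  · funext j
    rw [partialSum_const, Function.comp_apply, hangle, Equiv.apply_symm_apply]

end Gaps

/-! ### The maximum over the simplex and its quadratic nature -/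

section Maximum

variable {k : ℕ}

/-- `arcKernel g` is maximal only at the vertices of a regular polygon. -/
def OnlyRegularMax (g : ℝ → ℝ) (k : ℕ) : Prop :=
  ∀ V : Fin (k + 1) → Circle, (∀ W : Fin (k + 1) → Circle, arcKernel g W ≤ arcKernel g V) →
    IsRegularPolygon V

/-- The side arc of a regular `m`-gon. -/
def regArc (m : ℕ) : ℝ := 2 * Real.pi / (m : ℝ)

theorem mul_regArc (k : ℕ) : ((k + 1 : ℕ) : ℝ) * regArc (k + 1) = 2 * Real.pi := by
  rw [regArc]; field_simp

theorem regArc_pos (k : ℕ) : 0 < regArc (k + 1) := by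
  have := Real.two_pi_pos
  unfold regArc
  positivity

theorem const_mem_gapSimplex (k : ℕ) : (fun _ => regArc (k + 1)) ∈ gapSimplex (k + 1) := by
  refine ⟨fun _ => (regArc_pos k).le, ?_⟩
  rw [← mul_regArc k]
  simp

/-- The sum of `g` does not see the order of the arcs. Sorting them puts the largest, necessarily
positive, arc last, so that the maximiser is realised by points of the circle and the hypothesis on
configurations applies. -/
theorem eq_regArc_of_isMaxOn {g : ℝ → ℝ} (hmax : OnlyRegularMax g k)
    {s : Fin (k + 1) → ℝ} (hs : s ∈ gapSimplex (k + 1))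
    (hsmax : IsMaxOn (gapSum g) (gapSimplex (k + 1)) s) : s = fun _ => regArc (k + 1) := by
  set σ := Tuple.sort s with hσ
  have hperm : gapSum g (s ∘ σ) = gapSum g s := Equiv.sum_comp σ fun i => g (s i)
  have hmem : s ∘ σ ∈ gapSimplex (k + 1) :=
    ⟨fun i => hs.1 _, (Equiv.sum_comp σ s).trans hs.2⟩
  have hlast : 0 < (s ∘ σ) (Fin.last k) := by
    by_contra hcon
    have : ∑ i, (s ∘ σ) i ≤ 0 := Finset.sum_nonpos fun i _ =>
      (Tuple.monotone_sort s (Fin.le_last i)).trans (not_lt.1 hcon)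
    rw [hmem.2] at this
    linarith [Real.two_pi_pos]
  obtain ⟨V, hV⟩ := exists_gaps_eq hmem hlast
  have hreg : IsRegularPolygon V := hmax V fun W => by
    rw [arcKernel_eq_gapSum, arcKernel_eq_gapSum, hV, hperm]
    exact hsmax (gaps_mem_gapSimplex W)
  funext i
  have := hreg.gaps_eq (σ.symm i)
  rw [hV] at this
  simpa [regArc] using this

theorem gapSum_const (g : ℝ → ℝ) (m : ℕ) (a : ℝ) :
    gapSum g (fun _ : Fin m => a) = m * g a := by
  simp [gapSum]

theorem gapSum_le {g : ℝ → ℝ} (hg : ContinuousOn g (Set.Icc 0 (2 * Real.pi)))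
    (hmax : OnlyRegularMax g k) {s : Fin (k + 1) → ℝ} (hs : s ∈ gapSimplex (k + 1)) :
    gapSum g s ≤ (k + 1 : ℕ) * g (regArc (k + 1)) := by
  obtain ⟨s₀, hs₀, h⟩ := (isCompact_gapSimplex (k + 1)).exists_isMaxOn
    ⟨_, const_mem_gapSimplex k⟩ (continuousOn_gapSum hg)
  have := h hs
  rw [eq_regArc_of_isMaxOn hmax hs₀ h] at this
  rw [← gapSum_const]
  exact this

/-- Compactness: on the closed part of the simplex where some arc is at least `r` away from `regArc
(k + 1)`, the maximum is attained and, by uniqueness of the maximiser, strictly smaller. -/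
theorem exists_forall_near_of_gapSum_gt {g : ℝ → ℝ}
    (hg : ContinuousOn g (Set.Icc 0 (2 * Real.pi))) (hmax : OnlyRegularMax g k) {r : ℝ}
    (hr : 0 < r) : ∃ η > 0, ∀ s ∈ gapSimplex (k + 1),
      (k + 1 : ℕ) * g (regArc (k + 1)) - η < gapSum g s → ∀ i, |s i - regArc (k + 1)| < r := by
  set B := gapSimplex (k + 1) ∩ {s | ∃ i, r ≤ |s i - regArc (k + 1)|} with hB
  have hBc : IsCompact B := by
    refine (isCompact_gapSimplex (k + 1)).inter_right ?_
    rw [Set.ofPred_exists]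
    exact isClosed_iUnion_of_finite fun i => isClosed_le continuous_const (by fun_prop)
  rcases B.eq_empty_or_nonempty with hBe | hBn
  · refine ⟨1, one_pos, fun s hs _ i => ?_⟩
    by_contra hcon
    have : s ∈ B := ⟨hs, i, not_lt.1 hcon⟩
    rw [hBe] at this
    exact this
  · obtain ⟨s₀, hs₀, h⟩ := hBc.exists_isMaxOn hBn
      ((continuousOn_gapSum hg).mono Set.inter_subset_left)
    have hlt : gapSum g s₀ < (k + 1 : ℕ) * g (regArc (k + 1)) := by
      refine lt_of_le_of_ne (gapSum_le hg hmax hs₀.1) fun heq => ?_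
      have hmx : IsMaxOn (gapSum g) (gapSimplex (k + 1)) s₀ := fun s hs => by
        show gapSum g s ≤ gapSum g s₀
        rw [heq]
        exact gapSum_le hg hmax hs
      have he := eq_regArc_of_isMaxOn hmax hs₀.1 hmx
      obtain ⟨i, hi⟩ := hs₀.2
      rw [he] at hi
      simp at hi
      linarith
    refine ⟨(k + 1 : ℕ) * g (regArc (k + 1)) - gapSum g s₀, sub_pos.2 hlt, fun s hs hgt i => ?_⟩
    by_contra hcon
    have : gapSum g s ≤ gapSum g s₀ := h ⟨hs, i, not_lt.1 hcon⟩
    linarith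

theorem isLittleO_taylor_two {g : ℝ → ℝ} {a : ℝ} (hg : ContDiffAt ℝ 3 g a) :
    (fun x => g x - (g a + deriv g a * (x - a) + iteratedDeriv 2 g a / 2 * (x - a) ^ 2))
      =o[𝓝 a] fun x => (x - a) ^ 2 := by
  obtain ⟨u, hu, hcu⟩ := hg.contDiffOn (m := 2) (by norm_num) (by simp)
  obtain ⟨r, hr, hru⟩ := Metric.mem_nhds_iff.1 (by simpa using hu)
  have hball : ContDiffOn ℝ (2 : ℕ) g (Metric.ball a r) := hcu.mono hru
  have hmem : a ∈ Metric.ball a r := Metric.mem_ball_self hr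
  have h := taylor_isLittleO (convex_ball a r) hmem hball
  rw [Metric.isOpen_ball.nhdsWithin_eq hmem] at h
  refine h.congr_left fun x => ?_
  rw [taylorWithinEval_succ, taylorWithinEval_succ, taylor_within_zero_eval,
    iteratedDerivWithin_of_isOpen Metric.isOpen_ball hmem,
    iteratedDerivWithin_of_isOpen Metric.isOpen_ball hmem]
  simp [iteratedDeriv_one]
  ring

/-- If `c = g''(a)` were positive, lengthening one arc by `h` and shortening another by `h` would
cancel the first order terms and gain at least `2(c/2 - c/4)h²`, contradicting maximality. Two
distinct arcs exist because `k ≥ 1`. -/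
theorem iteratedDeriv_two_neg (hk : 1 ≤ k) {g : ℝ → ℝ}
    (hg : ContinuousOn g (Set.Icc 0 (2 * Real.pi))) (hmax : OnlyRegularMax g k)
    (hs : ContDiffAt ℝ 3 g (regArc (k + 1))) (h2 : iteratedDeriv 2 g (regArc (k + 1)) ≠ 0) :
    iteratedDeriv 2 g (regArc (k + 1)) < 0 := by
  set a := regArc (k + 1) with ha
  refine lt_of_le_of_ne (not_lt.1 fun hpos => ?_) h2
  have ha0 : 0 < a := regArc_pos k
  set c := iteratedDeriv 2 g a with hc
  obtain ⟨r, hr, hb⟩ := Metric.eventually_nhds_iff.1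
    ((isLittleO_taylor_two hs).bound (show 0 < c / 4 by positivity))
  obtain ⟨h, hh0, hhr, hha⟩ : ∃ h, 0 < h ∧ h < r ∧ h < a :=
    ⟨min r a / 2, by positivity, by linarith [min_le_left r a, lt_min hr ha0],
      by linarith [min_le_right r a, lt_min hr ha0]⟩
  have hp := hb (y := a + h) (by simpa [Real.dist_eq, abs_of_pos hh0] using hhr)
  have hm := hb (y := a - h) (by simpa [Real.dist_eq, abs_of_pos hh0] using hhr)
  simp only [Real.norm_eq_abs, add_sub_cancel_left, sub_sub_cancel_left] at hp hm
  rw [abs_of_nonneg (sq_nonneg h)] at hp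
  rw [abs_of_nonneg (sq_nonneg (-h))] at hm
  have hp' := (abs_le.1 hp).1
  have hm' := (abs_le.1 hm).1
  have h01 : (0 : Fin (k + 1)) ≠ Fin.last k := by
    intro he
    have := congrArg Fin.val he
    simp at this
    omega
  have hval : ∀ F : ℝ → ℝ, ∑ i, F (Function.update (Function.update (fun _ : Fin (k + 1) => a) 0
      (a + h)) (Fin.last k) (a - h) i) = F (a + h) + F (a - h) + (k - 1 : ℝ) * F a := by
    intro F
    rw [← Finset.add_sum_erase _ _ (Finset.mem_univ (Fin.last k)),
      ← Finset.add_sum_erase _ _ (Finset.mem_erase.2 ⟨h01, Finset.mem_univ 0⟩)]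
    rw [Finset.sum_congr rfl (g := fun _ => F a)]
    · rw [Finset.sum_const, Finset.card_erase_of_mem (Finset.mem_erase.2 ⟨h01, Finset.mem_univ 0⟩),
        Finset.card_erase_of_mem (Finset.mem_univ _)]
      simp [Function.update_of_ne h01, Nat.cast_sub hk]
      ring
    · intro i hi
      simp only [Finset.mem_erase] at hi
      rw [Function.update_of_ne hi.2.1, Function.update_of_ne hi.1]
  have hmem : Function.update (Function.update (fun _ : Fin (k + 1) => a) 0
      (a + h)) (Fin.last k) (a - h) ∈ gapSimplex (k + 1) := by
    constructor
    · intro i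
      by_cases h1 : i = Fin.last k
      · subst h1; simp; linarith
      · by_cases h2 : i = 0
        · subst h2; simp [Function.update_of_ne h01]; linarith
        · simp [Function.update_of_ne h1, Function.update_of_ne h2]; linarith
    · have := hval id
      simp only [id] at this
      rw [this, ← mul_regArc k]
      push_cast
      ring
  have hle := gapSum_le hg hmax hmem
  unfold gapSum at hle
  rw [hval g] at hle
  push_cast at hle
  have : 0 < c * h ^ 2 := by positivity
  nlinarith

/-- Near the regular polygon the first order terms sum to zero because the total length is fixed,
and concavity leaves a deficit of at least `c/4` times the sum of squared deviations, where `c =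
-g''(a)`. Deficits too large for this regime are covered by the trivial bound `2π`. -/
theorem exists_sqrt_bound {g : ℝ → ℝ} (hk : 1 ≤ k)
    (hg : ContinuousOn g (Set.Icc 0 (2 * Real.pi))) (hmax : OnlyRegularMax g k)
    (hs : ContDiffAt ℝ 3 g (regArc (k + 1))) (h2 : iteratedDeriv 2 g (regArc (k + 1)) ≠ 0) :
    ∃ C > 0, ∀ δ > 0, ∀ s ∈ gapSimplex (k + 1),
      (k + 1 : ℕ) * g (regArc (k + 1)) - δ ≤ gapSum g s →
        ∀ i, |s i - regArc (k + 1)| ≤ C * Real.sqrt δ := by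
  have hneg := iteratedDeriv_two_neg hk hg hmax hs h2
  set a := regArc (k + 1) with ha
  set c := -iteratedDeriv 2 g a with hc
  have hc0 : 0 < c := by linarith
  obtain ⟨r, hr, hb⟩ := Metric.eventually_nhds_iff.1
    ((isLittleO_taylor_two hs).bound (show 0 < c / 4 by positivity))
  obtain ⟨η, hη, hnear⟩ := exists_forall_near_of_gapSum_gt hg hmax hr
  have hpi := Real.two_pi_pos
  -- The first entry solves `c/4 · x² ≤ δ`; the second makes the bound at least `2π` as soon as `δ ≥
  -- η`.
  refine ⟨max (2 / Real.sqrt c) (2 * Real.pi / Real.sqrt η), by positivity,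
    fun δ hδ s hsm hge i => ?_⟩
  rcases lt_or_ge δ η with hlt | hle
  · have hn := hnear s hsm (by linarith)
    have hterm : ∀ j, g (s j) ≤ g a + deriv g a * (s j - a) - c / 4 * (s j - a) ^ 2 := by
      intro j
      have := hb (y := s j) (by simpa [Real.dist_eq] using hn j)
      simp only [Real.norm_eq_abs] at this
      rw [abs_of_nonneg (sq_nonneg (s j - a))] at this
      have := (abs_le.1 this).2
      have hc' : iteratedDeriv 2 g a = -c := by rw [hc]; ring
      rw [hc'] at this
      linarith
    have hsum : gapSum g s ≤ (k + 1 : ℕ) * g a - c / 4 * ∑ j, (s j - a) ^ 2 := by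
      calc gapSum g s ≤ ∑ j, (g a + deriv g a * (s j - a) - c / 4 * (s j - a) ^ 2) :=
            Finset.sum_le_sum fun j _ => hterm j
        _ = _ := by
          rw [Finset.sum_sub_distrib, Finset.sum_add_distrib, ← Finset.mul_sum, ← Finset.mul_sum,
            Finset.sum_sub_distrib, hsm.2, ← mul_regArc k, ← ha]
          simp
    have h1 : (s i - a) ^ 2 ≤ ∑ j, (s j - a) ^ 2 :=
      Finset.single_le_sum (f := fun j => (s j - a) ^ 2) (fun j _ => sq_nonneg _)
        (Finset.mem_univ i)
    have h3 : (s i - a) ^ 2 ≤ 4 * δ / c := by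
      rw [le_div_iff₀ hc0]
      nlinarith
    have h4 : |s i - a| ≤ 2 / Real.sqrt c * Real.sqrt δ := by
      refine abs_le_of_sq_le_sq ?_ (by positivity)
      rw [mul_pow, div_pow, Real.sq_sqrt hc0.le, Real.sq_sqrt hδ.le]
      calc _ ≤ _ := h3
        _ = _ := by ring
    exact h4.trans (mul_le_mul_of_nonneg_right (le_max_left _ _) (Real.sqrt_nonneg _))
  · have h1 : |s i - a| ≤ 2 * Real.pi := by
      have h2 := mem_Icc_of_mem_gapSimplex hsm i
      have h3 := mem_Icc_of_mem_gapSimplex (const_mem_gapSimplex k) i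
      rw [abs_le]
      constructor <;> [linarith [h2.1, h3.2]; linarith [h2.2, h3.1]]
    have hη0 : 0 < Real.sqrt η := Real.sqrt_pos.2 hη
    calc _ ≤ 2 * Real.pi := h1
      _ = 2 * Real.pi / Real.sqrt η * Real.sqrt η := by field_simp
      _ ≤ max (2 / Real.sqrt c) (2 * Real.pi / Real.sqrt η) * Real.sqrt δ := by
        gcongr
        exact le_max_right _ _

/-- The second order expansion of the sum of `g` over a balanced perturbation of the regular
polygon. -/
theorem tendsto_gapSum_sub_div {g : ℝ → ℝ} {a : ℝ} {m : ℕ} (hs : ContDiffAt ℝ 3 g a)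
    {y : Fin m → ℝ} (hy : ∑ i, y i = 0) :
    Tendsto (fun ε : ℝ => (m * g a - gapSum g fun i => a + ε * y i) / ε ^ 2) (𝓝[>] 0)
      (𝓝 (-iteratedDeriv 2 g a / 2 * ∑ i, y i ^ 2)) := by
  set c := iteratedDeriv 2 g a with hc
  have hlim : ∀ i, Tendsto (fun ε : ℝ => (g (a + ε * y i) - (g a + deriv g a * (ε * y i)
      + c / 2 * (ε * y i) ^ 2)) / ε ^ 2) (𝓝[>] 0) (𝓝 0) := by
    intro i
    have ht : Tendsto (fun ε : ℝ => a + ε * y i) (𝓝[>] 0) (𝓝 a) := by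
      have : Tendsto (fun ε : ℝ => a + ε * y i) (𝓝 0) (𝓝 (a + 0 * y i)) :=
        (Continuous.tendsto (by fun_prop) 0)
      simpa using this.mono_left nhdsWithin_le_nhds
    have h1 := (isLittleO_taylor_two hs).comp_tendsto ht
    simp only [Function.comp_def, add_sub_cancel_left] at h1
    refine (h1.trans_isBigO ?_).tendsto_div_nhds_zero
    refine Asymptotics.IsBigO.of_bound (y i ^ 2) (Eventually.of_forall fun ε => ?_)
    rw [mul_pow, norm_mul, mul_comm]
    simp
  have hsum := tendsto_finsetSum Finset.univ fun i _ => hlim i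
  have := (tendsto_const_nhds (x := -c / 2 * ∑ i, y i ^ 2)).sub hsum
  simp only [Finset.sum_const_zero, sub_zero] at this
  refine this.congr' ?_
  filter_upwards [self_mem_nhdsWithin] with ε hε
  have hε0 : ε ≠ 0 := ne_of_gt hε
  rw [← Finset.sum_div, Finset.sum_sub_distrib, Finset.sum_add_distrib, Finset.sum_add_distrib]
  -- The first order term is a multiple of `∑ y i = 0`, so the deficit is purely quadratic.
  simp only [mul_pow, ← Finset.mul_sum, hy, gapSum]
  simp
  field_simp
  ring

end Maximum

/-! ### Measurability of the kernel -/

section Measurability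

variable {k : ℕ}

theorem measurable_baseAngles (j : Fin (k + 1)) :
    Measurable fun U : Fin (k + 1) → Circle => baseAngles U j := by
  have h1 : Measurable fun U : Fin (k + 1) → Circle =>
      Complex.arg ((U j / U 0 : Circle) : ℂ) := by
    refine Complex.measurable_arg.comp (Continuous.measurable ?_)
    exact continuous_subtype_val.comp ((continuous_apply j).div' (continuous_apply 0))
  simp only [baseAngles, ccwAngle, toIcoMod, toIcoDiv_eq_floor]
  refine h1.sub ?_
  simp only [zsmul_eq_mul]
  refine Measurable.mul ?_ measurable_const
  exact (measurable_of_countable (fun n : ℤ => (n : ℝ))).comp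
    (((h1.sub_const 0).div_const _).floor)

theorem measurableSet_sort_eq {n : ℕ} (σ : Equiv.Perm (Fin n)) :
    MeasurableSet {x : Fin n → ℝ | σ = Tuple.sort x} := by
  simp only [Tuple.eq_sort_iff, Monotone]
  measurability

/-- The sorting permutation takes finitely many values, each on a measurable set, and the map is a
coordinate projection on each of these pieces. -/
theorem measurable_apply_sort {n : ℕ} (i : Fin n) :
    Measurable fun x : Fin n → ℝ => x (Tuple.sort x i) := by
  have : (fun x : Fin n → ℝ => x (Tuple.sort x i))
      = fun x => ∑ σ : Equiv.Perm (Fin n),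
        {x : Fin n → ℝ | σ = Tuple.sort x}.indicator (fun x => x (σ i)) x := by
    funext x
    rw [Finset.sum_eq_single (Tuple.sort x)]
    · simp
    · intro σ _ hσ
      simp [hσ]
    · simp
  rw [this]
  exact Finset.measurable_fun_sum _ fun σ _ =>
    (measurable_pi_apply _).indicator (measurableSet_sort_eq σ)

theorem measurable_orderedAngles (i : Fin (k + 1 + 1)) :
    Measurable fun U : Fin (k + 1) → Circle => orderedAngles U i := by
  simp only [orderedAngles_eq_snoc]
  refine Fin.lastCases ?_ (fun j => ?_) i
  · simp only [Fin.snoc_last]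
    exact measurable_const
  · simp only [Fin.snoc_castSucc]
    exact (measurable_apply_sort j).comp (measurable_pi_lambda _ measurable_baseAngles)

theorem measurable_arcKernel {g : ℝ → ℝ} (hg : ContinuousOn g (Set.Icc 0 (2 * Real.pi))) :
    Measurable fun U : Fin (k + 1) → Circle => arcKernel g U := by
  -- Nothing is known about `g` off `[0, 2π]`, so it is replaced by its constant extension, which
  -- agrees with it on all arcs.
  have hc : Continuous (Set.IccExtend Real.two_pi_pos.le
      ((Set.Icc 0 (2 * Real.pi)).domRestrict g)) := hg.domRestrict.Icc_extend'
  have : (fun U : Fin (k + 1) → Circle => arcKernel g U) = fun U => ∑ i,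
      Set.IccExtend Real.two_pi_pos.le ((Set.Icc 0 (2 * Real.pi)).domRestrict g) (gaps U i) := by
    funext U
    refine Finset.sum_congr rfl fun i _ => ?_
    rw [Set.IccExtend_of_mem _ _ (mem_Icc_of_mem_gapSimplex (gaps_mem_gapSimplex U) i)]
    rfl
  rw [this]
  refine Finset.measurable_fun_sum _ fun i _ => hc.measurable.comp ?_
  exact (measurable_orderedAngles _).sub (measurable_orderedAngles _)

end Measurability

/-! ### Near-maximal configurations have nearly equal `m`-th powers -/

section PowerDistance

variable {k : ℕ}

theorem norm_exp_sub_one_le (x : ℝ) : ‖(Circle.exp x : ℂ) - 1‖ ≤ |x| := by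
  have := Complex.norm_exp_I_mul_ofReal_sub_one x
  rw [Circle.coe_exp, mul_comm, this, Real.norm_eq_abs, abs_mul, abs_two]
  have h := Real.abs_sin_le_abs (x := x / 2)
  rw [abs_div, abs_two] at h
  linarith

/-- Jordan's inequality: a chord is at least `2/π` times the shorter arc it subtends. -/
theorem exists_int_abs_sub_le (x : ℝ) : |x - 2 * Real.pi * round (x / (2 * Real.pi))|
    ≤ Real.pi / 2 * ‖(Circle.exp x : ℂ) - 1‖ := by
  have hpi := Real.two_pi_pos
  set n := round (x / (2 * Real.pi)) with hn
  set y := x - 2 * Real.pi * n with hy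
  have hround := abs_sub_round (x / (2 * Real.pi))
  have hyb : |y| ≤ Real.pi := by
    have : y = 2 * Real.pi * (x / (2 * Real.pi) - n) := by rw [hy]; field_simp
    rw [this, abs_mul, abs_of_pos hpi]
    nlinarith
  have hexp : Circle.exp x = Circle.exp y := by
    rw [hy, Circle.exp_sub, Circle.exp_two_pi_mul_int, div_one]
  have hsin := Real.mul_abs_le_abs_sin (x := y / 2)
    (by rw [abs_div, abs_two]; linarith)
  rw [hexp, Circle.coe_exp, mul_comm (y : ℂ), Complex.norm_exp_I_mul_ofReal_sub_one,
    Real.norm_eq_abs, abs_mul, abs_two]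
  rw [abs_div, abs_two] at hsin
  have hpi' := Real.pi_pos
  calc |y| = Real.pi / 2 * (2 * (2 / Real.pi * (|y| / 2))) := by field_simp
    _ ≤ _ := by gcongr

theorem abs_orderedAngles_sub_le {V : Fin (k + 1) → Circle} {a e : ℝ}
    (h : ∀ i, |gaps V i - a| ≤ e) (i : Fin (k + 1 + 1)) :
    |orderedAngles V i - (i : ℕ) * a| ≤ (i : ℕ) * e := by
  refine Fin.induction ?_ (fun j hj => ?_) i
  · simp [orderedAngles_zero]
  · have : orderedAngles V j.succ = orderedAngles V j.castSucc + gaps V j := by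
      unfold gaps; ring
    rw [this]
    have h2 := h j
    rw [abs_le] at *
    simp only [Fin.val_succ, Fin.val_castSucc, Nat.cast_add, Nat.cast_one] at *
    constructor <;> linarith

/-- A point of rank `j` sits at angle `j · regArc (k + 1) + d` with `|d| ≤ j e`. Raising to the
power `k + 1` turns the first part into full turns and leaves the angle `(k + 1) d`. -/
theorem norm_pow_sub_pow_base_le {V : Fin (k + 1) → Circle} {e : ℝ} (he : 0 ≤ e)
    (h : ∀ i, |gaps V i - regArc (k + 1)| ≤ e) (i : Fin (k + 1)) :
    ‖(V i : ℂ) ^ (k + 1) - (V 0 : ℂ) ^ (k + 1)‖ ≤ ((k + 1 : ℕ) : ℝ) ^ 2 * e := by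
  set j := (Tuple.sort (baseAngles V)).symm i with hj
  have hb : orderedAngles V j.castSucc = baseAngles V i := by
    rw [orderedAngles_eq_snoc, Fin.snoc_castSucc, Function.comp_apply, hj, Equiv.apply_symm_apply]
  have herr := abs_orderedAngles_sub_le h j.castSucc
  rw [hb, Fin.val_castSucc] at herr
  set d := baseAngles V i - (j : ℕ) * regArc (k + 1) with hd
  have hV : V i = V 0 * Circle.exp (baseAngles V i) := by
    rw [baseAngles, exp_ccwAngle, mul_div_cancel]
  have hpow : Circle.exp (baseAngles V i) ^ (k + 1) = Circle.exp ((k + 1 : ℕ) * d) := by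
    rw [← Circle.exp_natCast_mul, Circle.exp_eq_exp]
    refine ⟨(j : ℕ), ?_⟩
    rw [← mul_regArc k, hd]
    push_cast
    ring
  have e1 : (V i : ℂ) ^ (k + 1) - (V 0 : ℂ) ^ (k + 1)
      = (V 0 : ℂ) ^ (k + 1) * ((Circle.exp ((k + 1 : ℕ) * d) : ℂ) - 1) := by
    rw [← hpow, hV]
    push_cast
    ring
  rw [e1, norm_mul, norm_pow, Circle.norm_coe, one_pow, one_mul]
  refine (norm_exp_sub_one_le _).trans ?_
  rw [abs_mul, abs_of_nonneg (by positivity : (0 : ℝ) ≤ ((k + 1 : ℕ) : ℝ)), sq, mul_assoc]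
  refine mul_le_mul_of_nonneg_left (herr.trans ?_) (by positivity)
  refine mul_le_mul_of_nonneg_right ?_ he
  exact_mod_cast j.2.le

/-- If the kernel is within `δ` of its maximum, then the `m`-th powers of the points are within a
multiple of `√δ` of each other. -/
theorem exists_norm_pow_sub_pow_le {g : ℝ → ℝ} (hk : 1 ≤ k)
    (hg : ContinuousOn g (Set.Icc 0 (2 * Real.pi))) (hmax : OnlyRegularMax g k)
    (hs : ContDiffAt ℝ 3 g (regArc (k + 1))) (h2 : iteratedDeriv 2 g (regArc (k + 1)) ≠ 0) :
    ∃ C > 0, ∀ δ > 0, ∀ V : Fin (k + 1) → Circle,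
      (k + 1 : ℕ) * g (regArc (k + 1)) - δ ≤ arcKernel g V →
        ∀ i j, ‖(V i : ℂ) ^ (k + 1) - (V j : ℂ) ^ (k + 1)‖ ≤ C * Real.sqrt δ := by
  obtain ⟨C, hC, hCb⟩ := exists_sqrt_bound hk hg hmax hs h2
  refine ⟨2 * (((k + 1 : ℕ) : ℝ) ^ 2 * C), by positivity, fun δ hδ V hV i j => ?_⟩
  have h := hCb δ hδ (gaps V) (gaps_mem_gapSimplex V) hV
  have hb := norm_pow_sub_pow_base_le (by positivity) h
  have hj := hb j
  rw [norm_sub_rev] at hj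
  refine (norm_sub_le_norm_sub_add_norm_sub _ ((V 0 : ℂ) ^ (k + 1)) _).trans ?_
  refine (add_le_add (hb i) hj).trans (le_of_eq ?_)
  ring

end PowerDistance

/-! ### Probability that one point matches another up to a root of unity -/

section Law

variable {p : ℝ → ℝ}

theorem circleLaw_apply (p : ℝ → ℝ) {B : Set Circle} (hB : MeasurableSet B) :
    circleLaw p B = ∫⁻ x in Circle.exp ⁻¹' B ∩ Set.Ico 0 (2 * Real.pi), ENNReal.ofReal (p x) := by
  have hm : Measurable (Circle.exp : ℝ → Circle) := Circle.exp.continuous.measurable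
  rw [circleLaw, Measure.map_apply hm hB, withDensity_apply _ (hm hB),
    Measure.restrict_restrict (hm hB)]

theorem exists_circleLaw_le (hp : Continuous p) : ∃ M : ℝ, 0 ≤ M ∧ ∀ B, MeasurableSet B →
    circleLaw p B
      ≤ ENNReal.ofReal M * volume (Circle.exp ⁻¹' B ∩ Set.Ico 0 (2 * Real.pi)) := by
  obtain ⟨M, hM⟩ := isCompact_Icc.bddAbove_image (f := p)
    (K := Set.Icc 0 (2 * Real.pi)) hp.continuousOn
  refine ⟨max M 0, le_max_right _ _, fun B hB => ?_⟩
  rw [circleLaw_apply p hB, ← setLIntegral_const]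
  refine setLIntegral_mono measurable_const fun x hx => ENNReal.ofReal_le_ofReal ?_
  exact (hM ⟨x, ⟨hx.2.1, hx.2.2.le⟩, rfl⟩).trans (le_max_left _ _)

theorem measurableSet_norm_pow_sub_le (n : ℕ) (w : ℂ) (e : ℝ) :
    MeasurableSet {z : Circle | ‖(z : ℂ) ^ n - w‖ ≤ e} :=
  (isClosed_le (by fun_prop) continuous_const).measurableSet

/-- Points whose `n`-th powers are within `e` lie in boundedly many arcs of length `O(e)` around the
vertices of a regular `n`-gon through `w`, and the density is bounded. -/
theorem exists_circleLaw_near_le (hp : Continuous p) (n : ℕ) [NeZero n] :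
    ∃ B : ℝ, 0 ≤ B ∧ ∀ (w : Circle) (e : ℝ), 0 ≤ e →
      circleLaw p {z | ‖(z : ℂ) ^ n - (w : ℂ) ^ n‖ ≤ e} ≤ ENNReal.ofReal (B * e) := by
  obtain ⟨M, hM0, hM⟩ := exists_circleLaw_le hp
  have hpi := Real.two_pi_pos
  have hn : (0 : ℝ) < n := by exact_mod_cast Nat.pos_of_ne_zero (NeZero.ne n)
  -- `M` bounds the density, each arc has length `π e / n`, and since `|x - y| < 2π` the rotation
  -- index runs over `-n, …, n`, that is `2n + 1` values.
  refine ⟨M * ((2 * n + 1) * (Real.pi / n)), by positivity, fun w e he => ?_⟩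
  refine (hM _ (measurableSet_norm_pow_sub_le n _ e)).trans ?_
  set y := ccwAngle 1 w with hy
  have hyI := ccwAngle_mem_Ico 1 w
  have hw : Circle.exp y = w := by rw [hy, exp_ccwAngle, div_one]
  rw [mul_assoc M, ENNReal.ofReal_mul hM0]
  gcongr
  have hsub : (Circle.exp ⁻¹' {z | ‖(z : ℂ) ^ n - (w : ℂ) ^ n‖ ≤ e} ∩ Set.Ico 0 (2 * Real.pi))
      ⊆ ⋃ l ∈ Finset.Icc (-(n : ℤ)) n,
        Metric.closedBall (y + 2 * Real.pi * l / n) (Real.pi * e / (2 * n)) := by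
    rintro x ⟨hx, hxI⟩
    have hdist : ‖(Circle.exp (n * (x - y)) : ℂ) - 1‖ ≤ e := by
      have e1 : (Circle.exp x : ℂ) ^ n - (w : ℂ) ^ n
          = (w : ℂ) ^ n * ((Circle.exp (n * (x - y)) : ℂ) - 1) := by
        have : Circle.exp x = w * Circle.exp (x - y) := by
          rw [← hw, ← Circle.exp_add]; congr 1; ring
        rw [this, Circle.exp_natCast_mul]
        push_cast
        ring
      have hx' : ‖(Circle.exp x : ℂ) ^ n - (w : ℂ) ^ n‖ ≤ e := hx
      rwa [e1, norm_mul, norm_pow, Circle.norm_coe, one_pow, one_mul] at hx'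
    have hr := exists_int_abs_sub_le (n * (x - y))
    set l := round (n * (x - y) / (2 * Real.pi)) with hl
    have hrl := abs_sub_round (n * (x - y) / (2 * Real.pi))
    rw [← hl] at hrl
    have hlt : |n * (x - y) / (2 * Real.pi)| < n := by
      rw [abs_div, abs_mul, abs_of_pos hn, abs_of_pos hpi, div_lt_iff₀ hpi]
      refine mul_lt_mul_of_pos_left ?_ hn
      rw [abs_lt]
      constructor <;> linarith [hyI.1, hyI.2, hxI.1, hxI.2]
    rw [abs_lt] at hlt
    rw [abs_le] at hrl
    have hl1 : l < (n : ℤ) + 1 := by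
      have : (l : ℝ) < n + 1 := by linarith [hlt.1, hlt.2]
      exact_mod_cast this
    have hl2 : -(n : ℤ) - 1 < l := by
      have : -(n : ℝ) - 1 < l := by linarith [hlt.1, hlt.2]
      exact_mod_cast this
    simp only [Set.mem_iUnion, Finset.mem_Icc, Metric.mem_closedBall, Real.dist_eq]
    refine ⟨l, ⟨by omega, by omega⟩, ?_⟩
    have e2 : x - (y + 2 * Real.pi * l / n) = (n * (x - y) - 2 * Real.pi * l) / n := by
      field_simp
      ring
    rw [e2, abs_div, abs_of_pos hn, div_le_iff₀ hn]
    calc _ ≤ _ := hr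
      _ ≤ Real.pi / 2 * e := by gcongr
      _ = _ := by field_simp
  refine (measure_mono hsub).trans ((measure_biUnion_finset_le _ _).trans ?_)
  simp only [Real.volume_closedBall, Finset.sum_const, Int.card_Icc]
  have hcard : ((n : ℤ) + 1 - -(n : ℤ)).toNat = 2 * n + 1 := by omega
  rw [hcard, nsmul_eq_mul, ← ENNReal.ofReal_natCast, ← ENNReal.ofReal_mul (by positivity)]
  refine ENNReal.ofReal_le_ofReal (le_of_eq ?_)
  push_cast
  field_simp

end Law

/-! ### Conditioning on one shared point -/

section Independence

variable {Ω ι : Type*} [MeasurableSpace Ω] {P : Measure Ω} [IsProbabilityMeasure P]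

/-- Given the value of `X i₀`, the remaining variables are still independent, and each meets its
constraint with probability at most `q`; Fubini finishes. -/
theorem measure_forall_mem_le_pow {α : Type*} [MeasurableSpace α] {X : ι → Ω → α} {μ : Measure α}
    (hX : ∀ i, Measurable (X i)) (hind : iIndepFun X P) (hlaw : ∀ i, P.map (X i) = μ)
    {E : Set (α × α)} (hE : MeasurableSet E) {q : ENNReal}
    (hq : ∀ y, μ (Prod.mk y ⁻¹' E) ≤ q) {i₀ : ι} {T : Finset ι} (hi₀ : i₀ ∉ T) :
    P {ω | ∀ i ∈ T, (X i₀ ω, X i ω) ∈ E} ≤ q ^ T.card := by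
  classical
  have hμ : IsProbabilityMeasure μ :=
    hlaw i₀ ▸ Measure.isProbabilityMeasure_map (hX i₀).aemeasurable
  have hpair : IndepFun (X i₀) (fun ω (i : T) => X i ω) P := by
    have := hind.indepFun_finset {i₀} T (by simpa using hi₀) hX
    have hφ : Measurable fun v : ({i₀} : Finset ι) → α => v ⟨i₀, by simp⟩ := measurable_pi_apply _
    exact this.comp hφ measurable_id
  have hT : P.map (fun ω (i : T) => X i ω) = Measure.pi fun _ => μ := by
    have h1 := (hind.precomp (g := fun i : T => (i : ι)) Subtype.val_injective)
    rw [iIndepFun_iff_map_fun_eq_pi_map (fun i : T => (hX i).aemeasurable)] at h1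
    rw [h1]
    simp only [hlaw]
  have hmeasT : Measurable fun ω (i : T) => X i ω := measurable_pi_lambda _ fun i => hX i
  have hprod := hpair.map_prod_eq_prod_map_map (hX i₀).aemeasurable hmeasT.aemeasurable
  rw [hT, hlaw] at hprod
  set S : Set (α × (T → α)) := {v | ∀ i : T, (v.1, v.2 i) ∈ E} with hS
  have hSm : MeasurableSet S := by
    rw [hS]
    simp only [Set.ofPred_forall]
    refine MeasurableSet.iInter fun i => ?_
    exact (measurable_fst.prodMk ((measurable_pi_apply i).comp measurable_snd)) hE
  have hset : {ω | ∀ i ∈ T, (X i₀ ω, X i ω) ∈ E}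
      = (fun ω => (X i₀ ω, fun i : T => X i ω)) ⁻¹' S := by
    ext ω
    simp [hS]
  rw [hset, ← Measure.map_apply ((hX i₀).prodMk hmeasT) hSm, hprod, Measure.prod_apply hSm]
  have hle : ∀ y, (Measure.pi fun _ : T => μ) (Prod.mk y ⁻¹' S) ≤ q ^ T.card := by
    intro y
    have : Prod.mk y ⁻¹' S = Set.univ.pi fun _ : T => Prod.mk y ⁻¹' E := by
      ext v
      simp [hS]
    rw [this, Measure.pi_pi, Finset.prod_const, Finset.card_univ, Fintype.card_coe]
    exact pow_le_pow_left' (hq y) _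
  calc _ ≤ ∫⁻ _, q ^ T.card ∂μ := lintegral_mono hle
    _ = _ := by simp

end Independence

/-! ### Densities of product measures -/

section ProductDensity

variable {α : Type*} [MeasurableSpace α]

theorem lintegral_pi_prod_eq_prod {μ : Measure α} [SigmaFinite μ] {n : ℕ}
    {f : Fin n → α → ENNReal} (hf : ∀ i, Measurable (f i)) :
    ∫⁻ x, ∏ i, f i (x i) ∂(Measure.pi fun _ => μ) = ∏ i, ∫⁻ a, f i a ∂μ := by
  induction n with
  | zero => simp
  | succ n ih =>
    have hm : Measurable fun x : Fin n → α => ∏ i, f i.succ (x i) :=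
      Finset.measurable_fun_prod _ fun i _ => (hf i.succ).comp (measurable_pi_apply i)
    rw [← (measurePreserving_piFinSuccAbove (fun _ : Fin (n + 1) => μ) 0).symm.lintegral_comp_emb
      (MeasurableEquiv.measurableEmbedding _)]
    simp only [MeasurableEquiv.piFinSuccAbove_symm_apply, Fin.insertNthEquiv_zero,
      Fin.consEquiv_apply, Fin.prod_univ_succ, Fin.cons_zero, Fin.cons_succ]
    rw [← ih fun i => hf i.succ, ← lintegral_prod_mul (hf 0).aemeasurable hm.aemeasurable]

theorem pi_withDensity_eq {μ : Measure α} [SigmaFinite μ] {n : ℕ} {f : α → ENNReal}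
    (hf : Measurable f) [SigmaFinite (μ.withDensity f)] :
    Measure.pi (fun _ : Fin n => μ.withDensity f)
      = (Measure.pi fun _ => μ).withDensity fun x => ∏ i, f (x i) := by
  refine Measure.pi_eq fun s hs => ?_
  rw [withDensity_apply _ (MeasurableSet.univ_pi hs), ← lintegral_indicator
    (MeasurableSet.univ_pi hs)]
  have : ((Set.univ.pi s).indicator fun x => ∏ i, f (x i))
      = fun x => ∏ i, (s i).indicator f (x i) := by
    funext x
    by_cases hx : x ∈ Set.univ.pi s
    · rw [Set.indicator_of_mem hx]
      exact Finset.prod_congr rfl fun i _ => (Set.indicator_of_mem (hx i (Set.mem_univ i)) _).symm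
    · rw [Set.indicator_of_notMem hx]
      obtain ⟨i, hi⟩ : ∃ i, x i ∉ s i := by simpa using hx
      exact (Finset.prod_eq_zero (Finset.mem_univ i) (Set.indicator_of_notMem hi _)).symm
  rw [this, lintegral_pi_prod_eq_prod fun i => hf.indicator (hs i)]
  refine Finset.prod_congr rfl fun i _ => ?_
  rw [lintegral_indicator (hs i), withDensity_apply _ (hs i)]

end ProductDensity

/-! ### Reduction of symmetric integrals to increasing coordinates -/

section Symmetrization

variable {k : ℕ}

theorem ae_injective_pi (k : ℕ) : ∀ᵐ x : Fin k → ℝ, Function.Injective x := by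
  have h : ∀ i j : Fin k, i ≠ j → ∀ᵐ x : Fin k → ℝ, x i ≠ x j := by
    intro i j hij
    set L : Submodule ℝ (Fin k → ℝ) :=
      LinearMap.ker (LinearMap.proj (R := ℝ) (φ := fun _ => ℝ) i - LinearMap.proj j) with hL
    have hne : L ≠ ⊤ := by
      intro htop
      have : Pi.single i (1 : ℝ) ∈ L := htop ▸ Submodule.mem_top
      simp [hL, Pi.single_eq_of_ne hij.symm] at this
    have h0 := Measure.addHaar_submodule (volume : Measure (Fin k → ℝ)) L hne
    refine measure_mono_null (fun x hx => ?_) h0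
    simp only [Set.mem_compl_iff, Set.mem_ofPred_eq, not_not] at hx
    simp [hL, hx]
  have h2 : ∀ᵐ x : Fin k → ℝ, ∀ i j : Fin k, i ≠ j → x i ≠ x j := by
    rw [ae_all_iff]; intro i
    rw [ae_all_iff]; intro j
    by_cases hij : i = j
    · exact Eventually.of_forall fun x h => absurd hij h
    · filter_upwards [h i j hij] with x hx _ using hx
  filter_upwards [h2] with x hx i j hij
  by_contra hne
  exact hx i j hne hij

theorem measurableSet_strictMono (k : ℕ) : MeasurableSet {x : Fin k → ℝ | StrictMono x} := by
  simp only [StrictMono]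
  measurability

theorem measurePreserving_comp_perm (σ : Equiv.Perm (Fin k)) :
    MeasurePreserving (fun x : Fin k → ℝ => x ∘ σ) := by
  have h : (fun x : Fin k → ℝ => x ∘ σ)
      = MeasurableEquiv.piCongrLeft (fun _ : Fin k => ℝ) σ.symm := by
    funext x i
    have := MeasurableEquiv.piCongrLeft_apply_apply (β := fun _ : Fin k => ℝ) σ.symm x (σ i)
    simpa using this.symm
  rw [h]
  exact volume_measurePreserving_piCongrLeft (fun _ : Fin k => ℝ) σ.symm

/-- Almost every point has distinct coordinates, hence exactly one permutation makes it increasing;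
the `k!` chambers contribute equally because permuting coordinates preserves volume. -/
theorem lintegral_eq_factorial_mul {Φ : (Fin k → ℝ) → ENNReal} (hΦ : Measurable Φ)
    (hsymm : ∀ (σ : Equiv.Perm (Fin k)) x, Φ (x ∘ σ) = Φ x) :
    ∫⁻ x, Φ x = (k.factorial : ENNReal) * ∫⁻ x in {x | StrictMono x}, Φ x := by
  have hS := measurableSet_strictMono k
  have h1 : ∫⁻ x, Φ x = ∫⁻ x, ∑ σ : Equiv.Perm (Fin k),
      ({x | StrictMono x}.indicator Φ) (x ∘ σ) := by
    refine lintegral_congr_ae ?_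
    filter_upwards [ae_injective_pi k] with x hx
    have hstrict : StrictMono (x ∘ Tuple.sort x) :=
      (Tuple.monotone_sort x).strictMono_of_injective (hx.comp (Equiv.injective _))
    rw [Finset.sum_eq_single (Tuple.sort x)]
    · rw [Set.indicator_of_mem (by exact hstrict), hsymm]
    · intro σ _ hσ
      refine Set.indicator_of_notMem (fun hmem => hσ ?_) _
      have hm : Monotone (x ∘ σ) := StrictMono.monotone hmem
      have := Tuple.comp_sort_eq_comp_iff_monotone.2 hm
      ext i
      exact congrArg Fin.val (hx (congrFun this i))
    · simp
  rw [h1, lintegral_finsetSum]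
  · have h2 : ∀ σ : Equiv.Perm (Fin k), ∫⁻ x, ({x | StrictMono x}.indicator Φ) (x ∘ σ)
        = ∫⁻ x in {x | StrictMono x}, Φ x := by
      intro σ
      rw [(measurePreserving_comp_perm σ).lintegral_comp (hΦ.indicator hS),
        lintegral_indicator hS]
    simp [h2, Fintype.card_perm]
  · intro σ _
    exact (hΦ.indicator hS).comp (measurePreserving_comp_perm σ).measurable

end Symmetrization

/-! ### Linear changes of variables and the volume of the limiting ellipsoid -/

section LinearChange

variable {k : ℕ}

theorem partialSum_eq_sum_ite (w : Fin k → ℝ) (i : Fin (k + 1)) :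
    Fin.partialSum w i = ∑ l, if l.castSucc < i then w l else 0 := by
  refine Fin.induction ?_ (fun j hj => ?_) i
  · simp
  · rw [Fin.partialSum_succ, hj, ← Fintype.sum_ite_eq j w, ← Finset.sum_add_distrib]
    refine Finset.sum_congr rfl fun l _ => ?_
    rcases lt_trichotomy l j with h | h | h
    · simp [h, h.le, h.ne', Fin.castSucc_lt_succ_iff]
    · simp [h]
    · simp [h, not_lt.2 h.le, h.ne, Fin.castSucc_lt_succ_iff]

/-- The linear map sending a family of increments to its partial sums. -/
def cumSum (k : ℕ) : (Fin k → ℝ) →ₗ[ℝ] (Fin k → ℝ) :=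
  Matrix.toLin' (Matrix.of fun j l : Fin k => if l ≤ j then 1 else 0)

theorem cumSum_apply (w : Fin k → ℝ) (j : Fin k) : cumSum k w j = Fin.partialSum w j.succ := by
  rw [partialSum_eq_sum_ite]
  simp [cumSum, Matrix.mulVec, dotProduct, Fin.castSucc_lt_succ_iff]

theorem det_cumSum (k : ℕ) : LinearMap.det (cumSum k) = 1 := by
  rw [cumSum, LinearMap.det_toLin', Matrix.det_of_isLowerTriangular]
  · simp
  · intro i j hij
    have : i < j := hij
    simp [not_le.2 this]

theorem measurePreserving_cumSum (k : ℕ) : MeasurePreserving (cumSum k) := by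
  refine ⟨(cumSum k).continuous_of_finiteDimensional.measurable, ?_⟩
  rw [Real.map_linearMap_volume_pi_eq_smul_volume_pi (by rw [det_cumSum]; exact one_ne_zero),
    det_cumSum]
  simp

/-- A linear map whose square length is `∑ yᵢ² + (∑ yᵢ)²`. -/
def shearSum (k : ℕ) : (Fin k → ℝ) →ₗ[ℝ] (Fin k → ℝ) :=
  Matrix.toLin' (1 + Matrix.replicateCol Unit (fun _ : Fin k => (Real.sqrt (k + 1) - 1) / k)
    * Matrix.replicateRow Unit (fun _ => (1 : ℝ)))

theorem shearSum_apply (y : Fin k → ℝ) (i : Fin k) :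
    shearSum k y i = y i + (Real.sqrt (k + 1) - 1) / k * ∑ j, y j := by
  simp [shearSum, Matrix.mulVec, dotProduct, Matrix.mul_apply, Finset.mul_sum]

theorem det_shearSum (hk : 1 ≤ k) : LinearMap.det (shearSum k) = Real.sqrt (k + 1) := by
  have hk0 : (k : ℝ) ≠ 0 := by positivity
  rw [shearSum, LinearMap.det_toLin', Matrix.det_one_add_replicateCol_mul_replicateRow]
  simp [dotProduct]
  field_simp
  ring

theorem sum_sq_shearSum (hk : 1 ≤ k) (y : Fin k → ℝ) :
    ∑ i, (shearSum k y i) ^ 2 = ∑ i, y i ^ 2 + (∑ i, y i) ^ 2 := by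
  have hk0 : (k : ℝ) ≠ 0 := by positivity
  have hs : Real.sqrt (k + 1) ^ 2 = k + 1 := Real.sq_sqrt (by positivity)
  set b := (Real.sqrt (k + 1) - 1) / k with hb
  set S := ∑ i, y i with hS
  -- This equation dictates the coefficient in `shearSum`: it makes the square of `1 + b J`, with
  -- `J` the all-ones matrix, equal to `1 + J`.
  have hb' : 2 * b + k * b ^ 2 = 1 := by
    rw [hb]; field_simp; nlinarith
  have : ∀ i, (shearSum k y i) ^ 2 = y i ^ 2 + 2 * b * S * y i + b ^ 2 * S ^ 2 := by
    intro i; rw [shearSum_apply]; ring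
  simp only [this, Finset.sum_add_distrib, ← Finset.mul_sum, Finset.sum_const, Finset.card_univ,
    Fintype.card_fin, nsmul_eq_mul, ← hS]
  linear_combination S ^ 2 * hb'

theorem volume_sum_sq_lt [NeZero k] {r : ℝ} (hr : 0 < r) :
    volume {y : Fin k → ℝ | ∑ i, y i ^ 2 < r ^ 2}
      = ENNReal.ofReal r ^ k
        * ENNReal.ofReal (Real.sqrt Real.pi ^ k / Real.Gamma (k / 2 + 1)) := by
  have h := EuclideanSpace.volume_ball (Fin k) (0 : EuclideanSpace ℝ (Fin k)) r
  rw [Fintype.card_fin] at h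
  rw [← h, ← (PiLp.volume_preserving_toLp (Fin k)).measure_preimage
    Metric.isOpen_ball.measurableSet.nullMeasurableSet]
  congr 1
  ext y
  simp only [Set.mem_ofPred_eq, Set.mem_preimage, Metric.mem_ball, dist_zero_right,
    EuclideanSpace.norm_eq, Real.norm_eq_abs, sq_abs]
  rw [Real.sqrt_lt' hr]

theorem volume_sum_sq_eq [NeZero k] {r : ℝ} (hr : 0 < r) :
    volume {y : Fin k → ℝ | ∑ i, y i ^ 2 = r ^ 2} = 0 := by
  rw [← Measure.addHaar_sphere_of_ne_zero volume (0 : EuclideanSpace ℝ (Fin k)) hr.ne',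
    ← (PiLp.volume_preserving_toLp (Fin k)).measure_preimage
    Metric.isClosed_sphere.measurableSet.nullMeasurableSet]
  congr 1
  ext y
  simp only [Set.mem_ofPred_eq, Set.mem_preimage, mem_sphere_zero_iff_norm,
    EuclideanSpace.norm_eq, Real.norm_eq_abs, sq_abs]
  rw [Real.sqrt_eq_iff_eq_sq (Finset.sum_nonneg fun i _ => sq_nonneg _) hr.le]

/-- `shearSum` carries the ellipsoid onto a round ball, and its determinant `√(k + 1)` is the source
of `√m` in the constant `K`. -/
theorem volume_ellipsoid (hk : 1 ≤ k) {r : ℝ} (hr : 0 < r) :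
    volume {y : Fin k → ℝ | ∑ i, y i ^ 2 + (∑ i, y i) ^ 2 < r ^ 2}
      = ENNReal.ofReal (r ^ k * (Real.sqrt Real.pi ^ k / Real.Gamma (k / 2 + 1))
          / Real.sqrt (k + 1)) := by
  have : NeZero k := ⟨by omega⟩
  have hset : {y : Fin k → ℝ | ∑ i, y i ^ 2 + (∑ i, y i) ^ 2 < r ^ 2}
      = shearSum k ⁻¹' {y | ∑ i, y i ^ 2 < r ^ 2} := by
    ext y
    simp only [Set.mem_ofPred_eq, Set.mem_preimage, sum_sq_shearSum hk]
  have hs : 0 < Real.sqrt (k + 1) := by positivity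
  have hG : 0 < Real.Gamma (k / 2 + 1) := Real.Gamma_pos_of_pos (by positivity)
  rw [hset, Measure.addHaar_preimage_linearMap _ (by rw [det_shearSum hk]; exact hs.ne'),
    det_shearSum hk, volume_sum_sq_lt hr, ← ENNReal.ofReal_pow hr.le,
    ← ENNReal.ofReal_mul (by positivity), ← ENNReal.ofReal_mul (by positivity),
    abs_of_pos (by positivity)]
  congr 1
  field_simp

/-- Pointwise convergence of the rescaled integrand is proved only off this boundary, so it has to
be null. -/
theorem volume_ellipsoid_boundary (hk : 1 ≤ k) {r : ℝ} (hr : 0 < r) :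
    volume {y : Fin k → ℝ | ∑ i, y i ^ 2 + (∑ i, y i) ^ 2 = r ^ 2} = 0 := by
  have : NeZero k := ⟨by omega⟩
  have hset : {y : Fin k → ℝ | ∑ i, y i ^ 2 + (∑ i, y i) ^ 2 = r ^ 2}
      = shearSum k ⁻¹' {y | ∑ i, y i ^ 2 = r ^ 2} := by
    ext y
    simp only [Set.mem_ofPred_eq, Set.mem_preimage, sum_sq_shearSum hk]
  have hs : 0 < Real.sqrt (k + 1) := by positivity
  rw [hset, Measure.addHaar_preimage_linearMap _ (by rw [det_shearSum hk]; exact hs.ne'),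
    volume_sum_sq_eq hr, mul_zero]

theorem lintegral_eq_pow_mul_lintegral_comp {f : (Fin k → ℝ) → ENNReal} (hf : Measurable f)
    (c : Fin k → ℝ) {ε : ℝ} (hε : 0 < ε) :
    ∫⁻ w, f w = ENNReal.ofReal (ε ^ k) * ∫⁻ y, f (c + ε • y) := by
  have h1 : ∫⁻ y, f (c + ε • y) = ∫⁻ w, f (c + w) ∂(Measure.map (ε • ·) volume) := by
    exact (lintegral_map (f := fun w => f (c + w)) (hf.comp (measurable_const_add c))
      (measurable_const_smul ε)).symm
  rw [h1, Measure.map_addHaar_smul _ hε.ne', lintegral_smul_measure, lintegral_add_left_eq_self,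
    smul_eq_mul, ← mul_assoc, ← ENNReal.ofReal_mul (by positivity)]
  simp [abs_of_pos hε, hε.ne']

end LinearChange

/-! ### Translation of integrals over a period -/

section Periodic

theorem lintegral_Ico_add_eq_of_periodic {f : ℝ → ENNReal} {T : ℝ} (hT : 0 < T)
    (hf : Function.Periodic f T) (t : ℝ) :
    ∫⁻ x in Set.Ico 0 T, f (t + x) = ∫⁻ x in Set.Ico 0 T, f x := by
  have h1 : ∫⁻ x in Set.Ico 0 T, f (t + x) = ∫⁻ x in Set.Ico t (t + T), f x := by
    have := (measurePreserving_add_left volume t).setLIntegral_comp_preimage_emb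
      (measurableEmbedding_addLeft t) f (Set.Ico t (t + T))
    rw [← this]
    congr 2
    simp
  rw [h1, setLIntegral_congr Ico_ae_eq_Ioc,
    setLIntegral_congr (μ := volume) (Ico_ae_eq_Ioc (a := 0))]
  have h2 := (isAddFundamentalDomain_Ioc hT t).setLIntegral_eq (isAddFundamentalDomain_Ioc hT 0) f
    hf.map_vadd_zmultiples
  simpa using h2

end Periodic

/-! ### Rotation and permutation symmetries of the kernel -/

section KernelSymmetry

variable {k : ℕ} (g : ℝ → ℝ)

theorem arcKernel_congr {U V : Fin (k + 1) → Circle}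
    (h : baseAngles U ∘ Tuple.sort (baseAngles U) = baseAngles V ∘ Tuple.sort (baseAngles V)) :
    arcKernel g U = arcKernel g V := by
  unfold arcKernel
  rw [orderedAngles_eq_snoc, orderedAngles_eq_snoc, h]

theorem arcKernel_mul_left (z : Circle) (V : Fin (k + 1) → Circle) :
    arcKernel g (fun j => z * V j) = arcKernel g V := by
  have : baseAngles (fun j => z * V j) = baseAngles V := by
    funext j
    simp [baseAngles, ccwAngle, mul_div_mul_left_eq_div]
  exact arcKernel_congr g (by rw [this])

/-- Fixing `0` keeps the base point of the angles, so sorting absorbs the permutation. These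
permutations suffice, because the first point is rotated away and only the other `k` angles are
symmetrised. -/
theorem arcKernel_comp_perm {σ : Equiv.Perm (Fin (k + 1))} (hσ : σ 0 = 0)
    (V : Fin (k + 1) → Circle) : arcKernel g (V ∘ σ) = arcKernel g V := by
  have : baseAngles (V ∘ σ) = baseAngles V ∘ σ := by
    funext j
    simp [baseAngles, hσ]
  exact arcKernel_congr g (by rw [this]; exact Tuple.comp_perm_comp_sort_eq_comp_sort)

/-- The points with polar angles `0, θ 0, …, θ (k - 1)`. -/
def anglePoints (θ : Fin k → ℝ) : Fin (k + 1) → Circle :=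
  Fin.cons 1 fun j => Circle.exp (θ j)

theorem continuous_anglePoints : Continuous (anglePoints (k := k)) := by
  refine continuous_pi fun i => ?_
  refine Fin.cases ?_ (fun j => ?_) i
  · exact continuous_const
  · exact Circle.exp.continuous.comp (continuous_apply j)

theorem baseAngles_anglePoints {θ : Fin k → ℝ} (hθ : ∀ j, θ j ∈ Set.Ico 0 (2 * Real.pi)) :
    baseAngles (anglePoints θ) = Fin.cons 0 θ := by
  funext i
  refine Fin.cases ?_ (fun j => ?_) i
  · exact ccwAngle_self _
  · refine ccwAngle_eq_of_exp_eq (by simpa using hθ j) ?_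
    simp [anglePoints]

theorem arcKernel_anglePoints_comp_perm (σ : Equiv.Perm (Fin k)) (θ : Fin k → ℝ) :
    arcKernel g (anglePoints (θ ∘ σ)) = arcKernel g (anglePoints θ) := by
  have : anglePoints (θ ∘ σ) = anglePoints θ ∘ Equiv.Perm.decomposeFin.symm (0, σ) := by
    funext i
    refine Fin.cases ?_ (fun j => ?_) i
    · simp [anglePoints]
    · simp [anglePoints]
  rw [this]
  exact arcKernel_comp_perm g (by simp) _

theorem cons_zero_cumSum (w : Fin k → ℝ) :
    (Fin.cons 0 (cumSum k w) : Fin (k + 1) → ℝ) = Fin.partialSum w := by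
  funext i
  refine Fin.cases ?_ (fun j => ?_) i
  · simp
  · simp [cumSum_apply]

theorem arcKernel_anglePoints_cumSum {w : Fin k → ℝ} (hw : ∀ j, 0 ≤ w j)
    (hlt : ∀ j, cumSum k w j ∈ Set.Ico 0 (2 * Real.pi)) :
    arcKernel g (anglePoints (cumSum k w))
      = gapSum g (Fin.snoc (α := fun _ => ℝ) w (2 * Real.pi - ∑ j, w j)) := by
  rw [arcKernel_eq_gapSum, gaps_eq_snoc_of_partialSum (w := w) (Equiv.refl _) hw]
  rw [baseAngles_anglePoints hlt, cons_zero_cumSum]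
  rfl

end KernelSymmetry

/-! ### The tail of the kernel as an integral over increments -/

section IntegralFormula

variable {k : ℕ} {g p : ℝ → ℝ}

theorem indicator_eq_indicator_of_iff {α β M : Type*} [Zero M] {s : Set α} {t : Set β}
    {f : α → M} {h : β → M} {a : α} {b : β} (hst : a ∈ s ↔ b ∈ t) (hfh : f a = h b) :
    s.indicator f a = t.indicator h b := by
  by_cases hb : b ∈ t
  · rw [Set.indicator_of_mem hb, Set.indicator_of_mem (hst.2 hb), hfh]
  · rw [Set.indicator_of_notMem hb, Set.indicator_of_notMem (mt hst.1 hb)]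

theorem lintegral_circleLaw (hp : Continuous p) {F : Circle → ENNReal} (hF : Measurable F) :
    ∫⁻ z, F z ∂(circleLaw p)
      = ∫⁻ x in Set.Ico 0 (2 * Real.pi), ENNReal.ofReal (p x) * F (Circle.exp x) := by
  have hme : Measurable (Circle.exp : ℝ → Circle) := Circle.exp.continuous.measurable
  rw [circleLaw, lintegral_map hF hme]
  exact lintegral_withDensity_eq_lintegral_mul _ hp.measurable.ennreal_ofReal (hF.comp hme)

/-- The cube `[0, 2π)ᵏ`. -/
def angleCube (k : ℕ) : Set (Fin k → ℝ) := Set.univ.pi fun _ => Set.Ico 0 (2 * Real.pi)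

theorem measurableSet_angleCube (k : ℕ) : MeasurableSet (angleCube k) :=
  MeasurableSet.univ_pi fun _ => measurableSet_Ico

/-- The overlap of the density with its translates by `θ`. -/
def overlap (p : ℝ → ℝ) (θ : Fin k → ℝ) : ℝ :=
  ∫ x in (0 : ℝ)..(2 * Real.pi), p x * ∏ j, p (x + θ j)

theorem continuous_overlap (hp : Continuous p) : Continuous (overlap (k := k) p) := by
  unfold overlap
  refine intervalIntegral.continuous_parametric_intervalIntegral_of_continuous' ?_ _ _
  fun_prop

theorem lintegral_eq_ofReal_overlap (hp : Continuous p) (hp0 : ∀ x, 0 ≤ p x) (θ : Fin k → ℝ) :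
    ∫⁻ x in Set.Ico 0 (2 * Real.pi), ENNReal.ofReal (p x) * ∏ j, ENNReal.ofReal (p (x + θ j))
      = ENNReal.ofReal (overlap p θ) := by
  have hc : Continuous fun x => p x * ∏ j, p (x + θ j) := by fun_prop
  rw [overlap, intervalIntegral.integral_of_le Real.two_pi_pos.le,
    ofReal_integral_eq_lintegral_ofReal, setLIntegral_congr Ico_ae_eq_Ioc]
  · refine lintegral_congr fun x => ?_
    rw [ENNReal.ofReal_mul (hp0 x), ENNReal.ofReal_prod_of_nonneg fun j _ => hp0 _]
  · exact (hc.integrableOn_Icc (a := 0) (b := 2 * Real.pi)).mono_set Set.Ioc_subset_Icc_self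
  · exact Eventually.of_forall fun x => mul_nonneg (hp0 x) (Finset.prod_nonneg fun j _ => hp0 _)

/-- The arc length on `[0, 2π)` weighted by the density seen from the angle `x`. -/
def shiftedDensity (p : ℝ → ℝ) (x : ℝ) : Measure ℝ :=
  (volume.restrict (Set.Ico 0 (2 * Real.pi))).withDensity fun θ => ENNReal.ofReal (p (x + θ))

/-- By periodicity the polar angles may be measured from `x` instead of `0`. This is used to express
the other points relative to the first one. -/
theorem circleLaw_eq_map_shiftedDensity (hper : Function.Periodic p (2 * Real.pi)) (x : ℝ) :
    circleLaw p = (shiftedDensity p x).map fun θ => Circle.exp x * Circle.exp θ := by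
  have hm : Measurable fun θ => Circle.exp x * Circle.exp θ := by
    exact (continuous_const.mul Circle.exp.continuous).measurable
  have hme : Measurable (Circle.exp : ℝ → Circle) := Circle.exp.continuous.measurable
  ext B hB
  have hper' : Function.Periodic (fun θ => (Circle.exp ⁻¹' B).indicator
      (fun y => ENNReal.ofReal (p y)) θ) (2 * Real.pi) := by
    intro y
    refine indicator_eq_indicator_of_iff ?_ (by rw [hper y])
    simp only [Set.mem_preimage, Circle.exp_add_two_pi]
  have := lintegral_Ico_add_eq_of_periodic Real.two_pi_pos hper' x
  rw [circleLaw, Measure.map_apply hme hB, withDensity_apply _ (hme hB), Measure.map_apply hm hB,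
    shiftedDensity, withDensity_apply _ (hm hB), ← lintegral_indicator (hme hB),
    ← lintegral_indicator (hm hB), ← this]
  refine lintegral_congr fun θ => ?_
  refine indicator_eq_indicator_of_iff ?_ rfl
  simp only [Set.mem_preimage, Circle.exp_add]

theorem isFiniteMeasure_shiftedDensity (hper : Function.Periodic p (2 * Real.pi))
    [IsProbabilityMeasure (circleLaw p)] (x : ℝ) :
    IsFiniteMeasure (shiftedDensity p x) := by
  have hm : Measurable fun θ => Circle.exp x * Circle.exp θ := by
    exact (continuous_const.mul Circle.exp.continuous).measurable
  have h := measure_univ (μ := circleLaw p)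
  rw [circleLaw_eq_map_shiftedDensity hper x, Measure.map_apply hm MeasurableSet.univ,
    Set.preimage_univ] at h
  exact ⟨by rw [h]; exact ENNReal.one_lt_top⟩

/-- With the first point at angle `x` and the others measured from it, rotation invariance removes
`x` from the event. It survives only in the densities, and Fubini integrates it out into `overlap`.
-/
theorem pi_circleLaw_setOf_le_arcKernel (hg : ContinuousOn g (Set.Icc 0 (2 * Real.pi)))
    (hp : Continuous p) (hp0 : ∀ x, 0 ≤ p x) (hper : Function.Periodic p (2 * Real.pi))
    [IsProbabilityMeasure (circleLaw p)] (L : ℝ) :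
    (Measure.pi fun _ : Fin (k + 1) => circleLaw p) {V | L ≤ arcKernel g V}
      = ∫⁻ θ in angleCube k ∩ {θ | L ≤ arcKernel g (anglePoints θ)},
          ENNReal.ofReal (overlap p θ) := by
  have hA : MeasurableSet {V : Fin (k + 1) → Circle | L ≤ arcKernel g V} :=
    measurableSet_le measurable_const (measurable_arcKernel hg)
  have hD : MeasurableSet {θ : Fin k → ℝ | L ≤ arcKernel g (anglePoints θ)} :=
    continuous_anglePoints.measurable hA
  have hfin := isFiniteMeasure_shiftedDensity hper
  have hfiber : ∀ x : ℝ, (Measure.pi fun _ : Fin k => circleLaw p)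
      {v | L ≤ arcKernel g (Fin.cons (Circle.exp x) v : Fin (k + 1) → Circle)}
      = ∫⁻ θ in angleCube k ∩ {θ | L ≤ arcKernel g (anglePoints θ)},
          ∏ j, ENNReal.ofReal (p (x + θ j)) := by
    intro x
    have hm : Measurable fun θ => Circle.exp x * Circle.exp θ := by
      exact (continuous_const.mul Circle.exp.continuous).measurable
    have hpm : Measurable fun θ => ENNReal.ofReal (p (x + θ)) :=
      (hp.comp (continuous_const_add x)).measurable.ennreal_ofReal
    have hmap : (Measure.pi fun _ : Fin k => circleLaw p)
        = (Measure.pi fun _ : Fin k => shiftedDensity p x).map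
          fun θ j => Circle.exp x * Circle.exp (θ j) := by
      have hsf : SigmaFinite
          ((shiftedDensity p x).map fun θ => Circle.exp x * Circle.exp θ) := by
        rw [← circleLaw_eq_map_shiftedDensity hper x]; infer_instance
      have h := Measure.pi_map_pi (ι := Fin k) (μ := fun _ => shiftedDensity p x)
        (f := fun _ θ => Circle.exp x * Circle.exp θ) (fun _ => hm.aemeasurable)
      simp only [← circleLaw_eq_map_shiftedDensity hper x] at h
      exact h.symm
    have hcons : Measurable fun v : Fin k → Circle =>
        (Fin.cons (Circle.exp x) v : Fin (k + 1) → Circle) := by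
      refine measurable_pi_lambda _ fun i => ?_
      refine Fin.cases ?_ (fun j => ?_) i
      · exact measurable_const
      · exact measurable_pi_apply j
    have hm' : Measurable fun (θ : Fin k → ℝ) (j : Fin k) =>
        Circle.exp x * Circle.exp (θ j) :=
      measurable_pi_lambda _ fun j => hm.comp (measurable_pi_apply j)
    have hB : MeasurableSet
        {v | L ≤ arcKernel g (Fin.cons (Circle.exp x) v : Fin (k + 1) → Circle)} := hcons hA
    rw [hmap, Measure.map_apply hm' hB]
    have hset : (fun (θ : Fin k → ℝ) (j : Fin k) => Circle.exp x * Circle.exp (θ j)) ⁻¹'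
        {v | L ≤ arcKernel g (Fin.cons (Circle.exp x) v : Fin (k + 1) → Circle)}
        = {θ | L ≤ arcKernel g (anglePoints θ)} := by
      ext θ
      simp only [Set.mem_preimage, Set.mem_ofPred_eq]
      rw [← arcKernel_mul_left g (Circle.exp x) (anglePoints θ)]
      congr! 2
      funext i
      refine Fin.cases ?_ (fun j => ?_) i <;> simp [anglePoints]
    have hsf' : SigmaFinite ((volume.restrict (Set.Ico 0 (2 * Real.pi))).withDensity
        fun θ => ENNReal.ofReal (p (x + θ))) := (hfin x).toSigmaFinite
    rw [hset]
    unfold shiftedDensity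
    rw [pi_withDensity_eq hpm, withDensity_apply _ hD, Set.inter_comm, ← Measure.restrict_pi_pi,
      Measure.restrict_restrict hD]
    rfl
  set e := MeasurableEquiv.piFinSuccAbove (fun _ : Fin (k + 1) => Circle) 0 with he
  have hmp := (measurePreserving_piFinSuccAbove (fun _ : Fin (k + 1) => circleLaw p) 0).symm
  have hS : MeasurableSet (e.symm ⁻¹' {V | L ≤ arcKernel g V}) := e.symm.measurable hA
  have hpx : Measurable fun x => ENNReal.ofReal (p x) := hp.measurable.ennreal_ofReal
  rw [← hmp.measure_preimage hA.nullMeasurableSet, Measure.prod_apply hS]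
  have hFm := measurable_measure_prodMk_left (ν := Measure.pi fun _ : Fin k => circleLaw p) hS
  have hslice : ∀ x : ℝ, Prod.mk (Circle.exp x) ⁻¹' (e.symm ⁻¹' {V | L ≤ arcKernel g V})
      = {v | L ≤ arcKernel g (Fin.cons (Circle.exp x) v : Fin (k + 1) → Circle)} := by
    intro x
    ext v
    simp only [he, MeasurableEquiv.piFinSuccAbove_symm_apply, Fin.insertNthEquiv_zero]
    rfl
  calc _ = ∫⁻ z, (Measure.pi fun _ : Fin k => circleLaw p)
          (Prod.mk z ⁻¹' (e.symm ⁻¹' {V | L ≤ arcKernel g V})) ∂(circleLaw p) := rfl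
    _ = ∫⁻ x in Set.Ico 0 (2 * Real.pi), ENNReal.ofReal (p x) *
          ∫⁻ θ in angleCube k ∩ {θ | L ≤ arcKernel g (anglePoints θ)},
            ∏ j, ENNReal.ofReal (p (x + θ j)) := by
        rw [lintegral_circleLaw hp hFm]
        refine lintegral_congr fun x => ?_
        rw [← hfiber x, ← hslice x]
    _ = ∫⁻ x in Set.Ico 0 (2 * Real.pi),
          ∫⁻ θ in angleCube k ∩ {θ | L ≤ arcKernel g (anglePoints θ)},
            ENNReal.ofReal (p x) * ∏ j, ENNReal.ofReal (p (x + θ j)) := by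
        refine lintegral_congr fun x => ?_
        rw [lintegral_const_mul' _ _ ENNReal.ofReal_ne_top]
    _ = ∫⁻ θ in angleCube k ∩ {θ | L ≤ arcKernel g (anglePoints θ)},
          ∫⁻ x in Set.Ico 0 (2 * Real.pi),
            ENNReal.ofReal (p x) * ∏ j, ENNReal.ofReal (p (x + θ j)) := by
        refine lintegral_lintegral_swap ?_
        refine Measurable.aemeasurable ?_
        refine (hpx.comp measurable_fst).mul (Finset.measurable_fun_prod _ fun j _ => ?_)
        exact hpx.comp (measurable_fst.add ((measurable_pi_apply j).comp measurable_snd))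
    _ = _ := lintegral_congr fun θ => lintegral_eq_ofReal_overlap hp hp0 θ

theorem overlap_comp_perm (p : ℝ → ℝ) (σ : Equiv.Perm (Fin k)) (θ : Fin k → ℝ) :
    overlap p (θ ∘ σ) = overlap p θ := by
  unfold overlap
  congr 1
  funext x
  rw [← Equiv.prod_comp σ fun j => p (x + θ j)]
  rfl

/-- The increments `w` of increasing angles in `[0, 2π)` at which the kernel is at least `L`. -/
def highRegion (g : ℝ → ℝ) (k : ℕ) (L : ℝ) : Set (Fin k → ℝ) :=
  {w | StrictMono (cumSum k w) ∧ cumSum k w ∈ angleCube k ∧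
    L ≤ arcKernel g (anglePoints (cumSum k w))}

theorem measurableSet_highRegion (hg : ContinuousOn g (Set.Icc 0 (2 * Real.pi))) (L : ℝ) :
    MeasurableSet (highRegion g k L) := by
  have hc := (measurePreserving_cumSum k).measurable
  refine (hc (measurableSet_strictMono k)).inter ((hc (measurableSet_angleCube k)).inter ?_)
  exact hc (continuous_anglePoints.measurable
    (measurableSet_le measurable_const (measurable_arcKernel hg)))

/-- Symmetry in the `k` angles restricts the integral to increasing ones at the price of `k!`, and
there the volume-preserving `cumSum` passes from angles to increments, where the kernel is a plain
sum of `g`. -/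
theorem pi_circleLaw_eq_factorial_mul (hg : ContinuousOn g (Set.Icc 0 (2 * Real.pi)))
    (hp : Continuous p) (hp0 : ∀ x, 0 ≤ p x) (hper : Function.Periodic p (2 * Real.pi))
    [IsProbabilityMeasure (circleLaw p)] (L : ℝ) :
    (Measure.pi fun _ : Fin (k + 1) => circleLaw p) {V | L ≤ arcKernel g V}
      = (k.factorial : ENNReal) * ∫⁻ w, (highRegion g k L).indicator
          (fun w => ENNReal.ofReal (overlap p (cumSum k w))) w := by
  have hA : MeasurableSet {V : Fin (k + 1) → Circle | L ≤ arcKernel g V} :=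
    measurableSet_le measurable_const (measurable_arcKernel hg)
  have hD : MeasurableSet (angleCube k ∩ {θ : Fin k → ℝ | L ≤ arcKernel g (anglePoints θ)}) :=
    (measurableSet_angleCube k).inter (continuous_anglePoints.measurable hA)
  have hR : Measurable fun θ : Fin k → ℝ => ENNReal.ofReal (overlap p θ) :=
    (continuous_overlap hp).measurable.ennreal_ofReal
  have hS := measurableSet_strictMono k
  rw [pi_circleLaw_setOf_le_arcKernel hg hp hp0 hper, ← lintegral_indicator hD,
    lintegral_eq_factorial_mul (hR.indicator hD)]
  · rw [← lintegral_indicator hS,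
      ← (measurePreserving_cumSum k).lintegral_comp ((hR.indicator hD).indicator hS)]
    congr 1
    refine lintegral_congr fun w => ?_
    rw [Set.indicator_indicator]
    by_cases h : w ∈ highRegion g k L
    · rw [Set.indicator_of_mem h, Set.indicator_of_mem]
      exact ⟨h.1, h.2.1, h.2.2⟩
    · rw [Set.indicator_of_notMem h, Set.indicator_of_notMem]
      exact fun hh => h ⟨hh.1, hh.2.1, hh.2.2⟩
  · intro σ θ
    have hiff : θ ∘ σ ∈ angleCube k ∩ {θ : Fin k → ℝ | L ≤ arcKernel g (anglePoints θ)}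
        ↔ θ ∈ angleCube k ∩ {θ : Fin k → ℝ | L ≤ arcKernel g (anglePoints θ)} := by
      simp only [Set.mem_inter_iff, Set.mem_ofPred_eq, arcKernel_anglePoints_comp_perm, angleCube,
        Set.mem_univ_pi, Function.comp_apply]
      rw [σ.forall_congr_right (q := fun j => θ j ∈ Set.Ico 0 (2 * Real.pi))]
    exact indicator_eq_indicator_of_iff hiff (by rw [overlap_comp_perm])

end IntegralFormula

/-! ### Rescaling around the regular polygon -/

section LocalAsymptotics

variable {k : ℕ} {g p : ℝ → ℝ}

theorem nonneg_of_cumSum {w : Fin k → ℝ} (hmono : Monotone (cumSum k w))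
    (h0 : ∀ j, 0 ≤ cumSum k w j) (j : Fin k) : 0 ≤ w j := by
  have hj : cumSum k w j = Fin.partialSum w j.castSucc + w j := by
    rw [cumSum_apply, Fin.partialSum_succ]
  rcases Fin.eq_zero_or_eq_succ j.castSucc with h | ⟨j', h⟩
  · rw [h, Fin.partialSum_zero, zero_add] at hj
    exact hj ▸ h0 j
  · rw [h, ← cumSum_apply] at hj
    have hle : j' ≤ j := by
      have := congrArg Fin.val h
      simp only [Fin.val_castSucc, Fin.val_succ] at this
      exact Fin.le_def.2 (by omega)
    have := hmono hle
    linarith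

theorem sum_lt_of_cumSum (hk : 1 ≤ k) {w : Fin k → ℝ} {b : ℝ} (h : ∀ j, cumSum k w j < b) :
    ∑ j, w j < b := by
  obtain ⟨k, rfl⟩ := Nat.exists_eq_add_of_le' hk
  rw [← partialSum_last, ← Fin.succ_last, ← cumSum_apply]
  exact h _

/-- Complete a family of arcs by the remaining arc of the circle. -/
def closeUp (w : Fin k → ℝ) : Fin (k + 1) → ℝ :=
  Fin.snoc (α := fun _ => ℝ) w (2 * Real.pi - ∑ j, w j)

theorem closeUp_mem_gapSimplex {w : Fin k → ℝ} (h0 : ∀ j, 0 ≤ w j)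
    (hsum : ∑ j, w j ≤ 2 * Real.pi) : closeUp w ∈ gapSimplex (k + 1) := by
  constructor
  · intro i
    refine Fin.lastCases ?_ (fun j => ?_) i
    · simpa [closeUp] using hsum
    · simpa [closeUp] using h0 j
  · rw [Fin.sum_univ_castSucc]
    simp [closeUp]

theorem mem_highRegion_iff {w : Fin k → ℝ} {L : ℝ} :
    w ∈ highRegion g k L ↔ (StrictMono (cumSum k w) ∧ cumSum k w ∈ angleCube k) ∧
      L ≤ gapSum g (closeUp w) := by
  unfold highRegion
  rw [Set.mem_ofPred_eq, ← and_assoc]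
  refine and_congr_right fun h => ?_
  have hc : ∀ j, cumSum k w j ∈ Set.Ico 0 (2 * Real.pi) := fun j => h.2 j (Set.mem_univ j)
  rw [arcKernel_anglePoints_cumSum g (nonneg_of_cumSum h.1.monotone fun j => (hc j).1) hc]
  rfl

theorem closeUp_mem_gapSimplex_of_cumSum (hk : 1 ≤ k) {w : Fin k → ℝ}
    (h : StrictMono (cumSum k w) ∧ cumSum k w ∈ angleCube k) :
    closeUp w ∈ gapSimplex (k + 1) :=
  closeUp_mem_gapSimplex
    (nonneg_of_cumSum h.1.monotone fun j => (h.2 j (Set.mem_univ j)).1)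
    (sum_lt_of_cumSum hk fun j => (h.2 j (Set.mem_univ j)).2).le

theorem cumSum_mem_of_pos {w : Fin k → ℝ} (h0 : ∀ j, 0 < w j) (hsum : ∑ j, w j < 2 * Real.pi) :
    StrictMono (cumSum k w) ∧ cumSum k w ∈ angleCube k := by
  have hstrict : StrictMono (Fin.partialSum w) := by
    rw [Fin.strictMono_iff_lt_succ]
    intro i
    rw [Fin.partialSum_succ]
    linarith [h0 i]
  refine ⟨fun i j hij => ?_, fun j _ => ⟨?_, ?_⟩⟩
  · rw [cumSum_apply, cumSum_apply]
    exact hstrict (Fin.succ_lt_succ_iff.2 hij)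
  · rw [cumSum_apply, ← Fin.partialSum_zero w]
    exact hstrict.monotone (Fin.zero_le _)
  · rw [cumSum_apply]
    refine lt_of_le_of_lt ?_ hsum
    rw [← partialSum_last]
    exact hstrict.monotone (Fin.le_last _)

/-- The base point of the rescaling: all arcs equal. -/
def regArcs (k : ℕ) : Fin k → ℝ := fun _ => regArc (k + 1)

theorem closeUp_regArcs_add (ε : ℝ) (y : Fin k → ℝ) :
    closeUp (regArcs k + ε • y) = fun i => regArc (k + 1)
      + ε * (Fin.snoc (α := fun _ => ℝ) y (-∑ j, y j) : Fin (k + 1) → ℝ) i := by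
  funext i
  refine Fin.lastCases ?_ (fun j => ?_) i
  · simp only [closeUp, Fin.snoc_last, Pi.add_apply, Pi.smul_apply, smul_eq_mul, regArcs,
      Finset.sum_add_distrib, ← Finset.mul_sum, ← mul_regArc k]
    simp
    ring
  · simp [closeUp, regArcs]

/-- The rescaled integrand near the regular polygon. -/
def localIntegrand (g p : ℝ → ℝ) (k : ℕ) (ε : ℝ) (y : Fin k → ℝ) : ENNReal :=
  (highRegion g k ((k + 1 : ℕ) * g (regArc (k + 1)) - ε ^ 2)).indicator
    (fun w => ENNReal.ofReal (overlap p (cumSum k w))) (regArcs k + ε • y)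

/-- Domination for the limit: by `exists_sqrt_bound` with `δ = ε²`, every arc deviates by at most
`Cε`, so after rescaling the support lies in a ball independent of `ε`, and the continuous overlap
is bounded on the cube of angles. -/
theorem exists_localIntegrand_le (hk : 1 ≤ k)
    (hg : ContinuousOn g (Set.Icc 0 (2 * Real.pi))) (hmax : OnlyRegularMax g k)
    (hs : ContDiffAt ℝ 3 g (regArc (k + 1))) (h2 : iteratedDeriv 2 g (regArc (k + 1)) ≠ 0)
    (hp : Continuous p) :
    ∃ C M : ℝ, ∀ ε > 0, ∀ y : Fin k → ℝ, localIntegrand g p k ε y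
      ≤ (Metric.closedBall 0 C).indicator (fun _ => ENNReal.ofReal M) y := by
  obtain ⟨C, hC, hCb⟩ := exists_sqrt_bound hk hg hmax hs h2
  obtain ⟨M, hM⟩ := (isCompact_univ_pi fun _ : Fin k =>
    isCompact_Icc (a := (0 : ℝ)) (b := 2 * Real.pi)).bddAbove_image
      (continuous_overlap (k := k) hp).continuousOn
  refine ⟨C, M, fun ε hε y => ?_⟩
  unfold localIntegrand
  by_cases hmem : regArcs k + ε • y ∈ highRegion g k ((k + 1 : ℕ) * g (regArc (k + 1)) - ε ^ 2)
  · have h := mem_highRegion_iff.1 hmem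
    have hb := hCb (ε ^ 2) (by positivity) _ (closeUp_mem_gapSimplex_of_cumSum hk h.1) h.2
    rw [Real.sqrt_sq hε.le] at hb
    have hy : y ∈ Metric.closedBall (0 : Fin k → ℝ) C := by
      rw [mem_closedBall_zero_iff, pi_norm_le_iff_of_nonneg hC.le]
      intro j
      have := hb j.castSucc
      simp only [closeUp_regArcs_add, Fin.snoc_castSucc] at this
      rw [add_sub_cancel_left, abs_mul, abs_of_pos hε,
        mul_comm] at this
      exact le_of_mul_le_mul_right this hε
    rw [Set.indicator_of_mem hmem, Set.indicator_of_mem hy]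
    refine ENNReal.ofReal_le_ofReal (hM ⟨_, fun j _ => ?_, rfl⟩)
    exact Set.Ico_subset_Icc_self (h.1.2 j (Set.mem_univ j))
  · rw [Set.indicator_of_notMem hmem]
    exact zero_le

/-- The limiting ellipsoid of rescaled increments. -/
def limitEllipsoid (k : ℕ) (r : ℝ) : Set (Fin k → ℝ) :=
  {y | ∑ i, y i ^ 2 + (∑ i, y i) ^ 2 < r ^ 2}

theorem tendsto_regArcs_add (y : Fin k → ℝ) :
    Tendsto (fun ε : ℝ => regArcs k + ε • y) (𝓝[>] 0) (𝓝 (regArcs k)) := by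
  have h : Continuous fun ε : ℝ => regArcs k + ε • y := by fun_prop
  have := (h.tendsto 0).mono_left (nhdsWithin_le_nhds (s := Set.Ioi 0))
  simpa using this

/-- The deficit divided by `ε²` tends to `c/2 · q`, where `c = -g''(a)` and `q` is the quadratic
form; the term `(∑ y)²` in `q` comes from the closing arc. Comparing the limit with `1` decides
membership for small `ε`, which gives the radius `√(2/c)`. -/
theorem tendsto_localIntegrand (hs : ContDiffAt ℝ 3 g (regArc (k + 1)))
    (hneg : iteratedDeriv 2 g (regArc (k + 1)) < 0) (hp : Continuous p) {y : Fin k → ℝ}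
    (hy : ∑ i, y i ^ 2 + (∑ i, y i) ^ 2
      ≠ Real.sqrt (2 / -iteratedDeriv 2 g (regArc (k + 1))) ^ 2) :
    Tendsto (fun ε => localIntegrand g p k ε y) (𝓝[>] 0)
      (𝓝 ((limitEllipsoid k (Real.sqrt (2 / -iteratedDeriv 2 g (regArc (k + 1))))).indicator
        (fun _ => ENNReal.ofReal (overlap p (cumSum k (regArcs k)))) y)) := by
  set c := -iteratedDeriv 2 g (regArc (k + 1)) with hc
  have hc0 : 0 < c := by linarith
  rw [Real.sq_sqrt (by positivity)] at hy
  set q := ∑ i, y i ^ 2 + (∑ i, y i) ^ 2 with hq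
  have hconf : ∀ᶠ ε in 𝓝[>] (0 : ℝ), StrictMono (cumSum k (regArcs k + ε • y)) ∧
      cumSum k (regArcs k + ε • y) ∈ angleCube k := by
    have h1 : ∀ j, ∀ᶠ ε in 𝓝[>] (0 : ℝ), 0 < (regArcs k + ε • y) j := fun j =>
      ((continuous_apply j).tendsto _ |>.comp (tendsto_regArcs_add y)).eventually
        (lt_mem_nhds (regArc_pos k))
    have h2 : ∀ᶠ ε in 𝓝[>] (0 : ℝ), ∑ j, (regArcs k + ε • y) j < 2 * Real.pi := by
      have hcont : Continuous fun w : Fin k → ℝ => ∑ j, w j := by fun_prop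
      refine ((hcont.tendsto _).comp (tendsto_regArcs_add y)).eventually (gt_mem_nhds ?_)
      rw [← mul_regArc k]
      simp only [regArcs, Finset.sum_const, Finset.card_univ, Fintype.card_fin, nsmul_eq_mul]
      have := regArc_pos k
      push_cast
      linarith
    filter_upwards [eventually_all.2 h1, h2] with ε h1 h2 using cumSum_mem_of_pos h1 h2
  have hsum0 : ∑ i, (Fin.snoc (α := fun _ => ℝ) y (-∑ j, y j) : Fin (k + 1) → ℝ) i = 0 := by
    rw [Fin.sum_univ_castSucc]; simp
  have hsq : ∑ i, (Fin.snoc (α := fun _ => ℝ) y (-∑ j, y j) : Fin (k + 1) → ℝ) i ^ 2 = q := by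
    rw [Fin.sum_univ_castSucc]; simp [hq]
  have hlim := tendsto_gapSum_sub_div hs hsum0
  simp only [hsq, ← hc, ← closeUp_regArcs_add] at hlim
  have hR : Tendsto (fun ε : ℝ => ENNReal.ofReal (overlap p (cumSum k (regArcs k + ε • y))))
      (𝓝[>] 0) (𝓝 (ENNReal.ofReal (overlap p (cumSum k (regArcs k))))) := by
    have hcont : Continuous fun w : Fin k → ℝ => ENNReal.ofReal (overlap p (cumSum k w)) :=
      ENNReal.continuous_ofReal.comp ((continuous_overlap hp).comp
        (cumSum k).continuous_of_finiteDimensional)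
    exact (hcont.tendsto _).comp (tendsto_regArcs_add y)
  rcases lt_or_gt_of_ne hy with hlt | hgt
  · have hin : y ∈ limitEllipsoid k (Real.sqrt (2 / c)) := by
      rw [limitEllipsoid, Set.mem_ofPred_eq, Real.sq_sqrt (by positivity)]
      exact hlt
    rw [Set.indicator_of_mem hin]
    have hval : c / 2 * q < 1 := by
      rw [lt_div_iff₀ hc0] at hlt
      linarith
    refine hR.congr' ?_
    filter_upwards [hconf, hlim.eventually (gt_mem_nhds hval), self_mem_nhdsWithin]
      with ε h1 h2 h3
    have hε : (0 : ℝ) < ε := h3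
    rw [div_lt_one (by positivity)] at h2
    have hmem : regArcs k + ε • y
        ∈ highRegion g k ((k + 1 : ℕ) * g (regArc (k + 1)) - ε ^ 2) :=
      mem_highRegion_iff.2 ⟨h1, by linarith⟩
    rw [localIntegrand, Set.indicator_of_mem hmem]
  · have hout : y ∉ limitEllipsoid k (Real.sqrt (2 / c)) := by
      rw [limitEllipsoid, Set.mem_ofPred_eq, Real.sq_sqrt (by positivity)]
      exact not_lt.2 hgt.le
    rw [Set.indicator_of_notMem hout]
    have hval : 1 < c / 2 * q := by
      rw [div_lt_iff₀ hc0] at hgt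
      linarith
    refine tendsto_const_nhds.congr' ?_
    filter_upwards [hlim.eventually (lt_mem_nhds hval), self_mem_nhdsWithin] with ε h2 h3
    have hε : (0 : ℝ) < ε := h3
    rw [one_lt_div (by positivity)] at h2
    refine (Set.indicator_of_notMem (fun hmem => ?_) _).symm
    have := (mem_highRegion_iff.1 hmem).2
    linarith

/-- The limit of `P (f ≥ max f - ε²) / εᵏ`, up to the factor `k!`. -/
def localConst (g p : ℝ → ℝ) (k : ℕ) : ℝ :=
  overlap p (cumSum k (regArcs k)) *
    (Real.sqrt (2 / -iteratedDeriv 2 g (regArc (k + 1))) ^ k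
      * (Real.sqrt Real.pi ^ k / Real.Gamma (k / 2 + 1)) / Real.sqrt (k + 1))

theorem overlap_nonneg (hp0 : ∀ x, 0 ≤ p x) (θ : Fin k → ℝ) : 0 ≤ overlap p θ :=
  intervalIntegral.integral_nonneg Real.two_pi_pos.le fun x _ =>
    mul_nonneg (hp0 x) (Finset.prod_nonneg fun _ _ => hp0 _)

theorem localConst_nonneg (g : ℝ → ℝ) (hp0 : ∀ x, 0 ≤ p x) : 0 ≤ localConst g p k := by
  have hG : 0 < Real.Gamma (k / 2 + 1) := Real.Gamma_pos_of_pos (by positivity)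
  have := overlap_nonneg hp0 (cumSum k (regArcs k))
  unfold localConst
  positivity

theorem tendsto_lintegral_localIntegrand (hk : 1 ≤ k)
    (hg : ContinuousOn g (Set.Icc 0 (2 * Real.pi))) (hmax : OnlyRegularMax g k)
    (hs : ContDiffAt ℝ 3 g (regArc (k + 1))) (h2 : iteratedDeriv 2 g (regArc (k + 1)) ≠ 0)
    (hp : Continuous p) (hp0 : ∀ x, 0 ≤ p x) :
    Tendsto (fun ε => ∫⁻ y, localIntegrand g p k ε y) (𝓝[>] 0)
      (𝓝 (ENNReal.ofReal (localConst g p k))) := by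
  have hneg := iteratedDeriv_two_neg hk hg hmax hs h2
  set r := Real.sqrt (2 / -iteratedDeriv 2 g (regArc (k + 1))) with hr
  have hr0 : 0 < r := Real.sqrt_pos.2 (by apply div_pos <;> linarith)
  have hE : MeasurableSet (limitEllipsoid k r) := measurableSet_lt (by fun_prop) measurable_const
  have hval : ∫⁻ y, (limitEllipsoid k r).indicator
      (fun _ => ENNReal.ofReal (overlap p (cumSum k (regArcs k)))) y
      = ENNReal.ofReal (localConst g p k) := by
    rw [lintegral_indicator hE, setLIntegral_const, limitEllipsoid, volume_ellipsoid hk hr0,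
      ← ENNReal.ofReal_mul (overlap_nonneg hp0 _), localConst]
  rw [← hval]
  obtain ⟨C, M, hCM⟩ := exists_localIntegrand_le hk hg hmax hs h2 hp
  refine tendsto_lintegral_filter_of_dominated_convergence
    ((Metric.closedBall (0 : Fin k → ℝ) C).indicator fun _ => ENNReal.ofReal M) ?_ ?_ ?_ ?_
  · refine Eventually.of_forall fun ε => ?_
    have hR : Measurable fun w : Fin k → ℝ => ENNReal.ofReal (overlap p (cumSum k w)) :=
      ((continuous_overlap hp).comp
        (cumSum k).continuous_of_finiteDimensional).measurable.ennreal_ofReal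
    exact (hR.indicator (measurableSet_highRegion hg _)).comp (by fun_prop)
  · filter_upwards [self_mem_nhdsWithin] with ε hε
    exact Eventually.of_forall fun y => hCM ε hε y
  · rw [lintegral_indicator Metric.isClosed_closedBall.measurableSet, setLIntegral_const]
    exact ENNReal.mul_ne_top ENNReal.ofReal_ne_top measure_closedBall_lt_top.ne
  · have h0 := volume_ellipsoid_boundary hk hr0
    have : ∀ᵐ y : Fin k → ℝ, ∑ i, y i ^ 2 + (∑ i, y i) ^ 2 ≠ r ^ 2 := by
      rw [ae_iff]
      simpa using h0
    filter_upwards [this] with y hy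
    exact tendsto_localIntegrand hs hneg hp hy

/-- The factor `ε ^ k` is the Jacobian of the rescaling of the `k` increments, and `k!` comes from
ordering the angles. -/
theorem tendsto_measureReal_le_arcKernel_div (hk : 1 ≤ k)
    (hg : ContinuousOn g (Set.Icc 0 (2 * Real.pi))) (hmax : OnlyRegularMax g k)
    (hs : ContDiffAt ℝ 3 g (regArc (k + 1))) (h2 : iteratedDeriv 2 g (regArc (k + 1)) ≠ 0)
    (hp : Continuous p) (hp0 : ∀ x, 0 ≤ p x) (hper : Function.Periodic p (2 * Real.pi))
    [IsProbabilityMeasure (circleLaw p)] :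
    Tendsto (fun ε : ℝ => (Measure.pi fun _ : Fin (k + 1) => circleLaw p).real
        {V | (k + 1 : ℕ) * g (regArc (k + 1)) - ε ^ 2 ≤ arcKernel g V} / ε ^ k) (𝓝[>] 0)
      (𝓝 (k.factorial * localConst g p k)) := by
  have h := (ENNReal.tendsto_toReal ENNReal.ofReal_ne_top).comp
    (tendsto_lintegral_localIntegrand hk hg hmax hs h2 hp hp0)
  rw [ENNReal.toReal_ofReal (localConst_nonneg g hp0)] at h
  refine (h.const_mul (k.factorial : ℝ)).congr' ?_
  filter_upwards [self_mem_nhdsWithin] with ε hε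
  have hε0 : (0 : ℝ) < ε := hε
  have hR : Measurable fun w : Fin k → ℝ => ENNReal.ofReal (overlap p (cumSum k w)) :=
    ((continuous_overlap hp).comp
      (cumSum k).continuous_of_finiteDimensional).measurable.ennreal_ofReal
  rw [measureReal_def, pi_circleLaw_eq_factorial_mul hg hp hp0 hper,
    lintegral_eq_pow_mul_lintegral_comp (hR.indicator (measurableSet_highRegion hg _))
      (regArcs k) hε0, ENNReal.toReal_mul, ENNReal.toReal_mul,
    ENNReal.toReal_ofReal (by positivity), ENNReal.toReal_natCast]
  have he : (ε ^ k) ≠ 0 := by positivity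
  simp only [Function.comp_apply, localIntegrand]
  field_simp

theorem overlap_regArcs (p : ℝ → ℝ) (k : ℕ) :
    overlap p (cumSum k (regArcs k)) = regularOverlap p (k + 1) := by
  unfold overlap regularOverlap
  congr 1
  funext x
  rw [Finset.prod_range_succ', ← Fin.prod_univ_eq_prod_range
    (fun l => p (x + 2 * Real.pi * ((l + 1 : ℕ) : ℝ) / ((k + 1 : ℕ) : ℝ))), mul_comm]
  congr 1
  · refine Finset.prod_congr rfl fun j _ => ?_
    rw [cumSum_apply]
    unfold regArcs
    rw [partialSum_const, regArc, Fin.val_succ]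
    congr 2
    ring
  · simp

/-- The squared radius `2/c`, with `c = -g''(a)`, and the `π` of the ball volume combine into
`(2π)^(k/2) / c^(k/2)`. -/
theorem localConst_eq_limitConst (p : ℝ → ℝ)
    (hneg : iteratedDeriv 2 g (regArc (k + 1)) < 0) :
    localConst g p k = limitConst g p (k + 1) := by
  have hneg' : iteratedDeriv 2 g (2 * Real.pi / ((k + 1 : ℕ) : ℝ)) < 0 := hneg
  have hpow : ∀ x : ℝ, 0 ≤ x → x ^ ((((k + 1 : ℕ) : ℝ) - 1) / 2) = Real.sqrt x ^ k := by
    intro x hx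
    rw [Real.sqrt_eq_rpow, ← Real.rpow_natCast, ← Real.rpow_mul hx]
    congr 1
    push_cast
    ring
  have hG : 0 < Real.Gamma (k / 2 + 1) := Real.Gamma_pos_of_pos (by positivity)
  have hGe : ((((k + 1 : ℕ) : ℝ)) + 1) / 2 = (k : ℝ) / 2 + 1 := by push_cast; ring
  have hsc : 0 < Real.sqrt (-iteratedDeriv 2 g (2 * Real.pi / ((k + 1 : ℕ) : ℝ))) :=
    Real.sqrt_pos.2 (by linarith)
  unfold localConst limitConst
  rw [overlap_regArcs, hpow _ Real.two_pi_pos.le, hpow _ (by linarith), hGe, regArc,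
    Real.sqrt_div (by norm_num), Real.sqrt_mul (by norm_num), div_pow, mul_pow, Nat.cast_add,
    Nat.cast_one] at *
  field_simp

end LocalAsymptotics

/-! ### Counting overlapping index tuples -/

section PairCounting

variable {m n : ℕ}

noncomputable instance fintypeOrderEmbedding (m n : ℕ) : Fintype (Fin m ↪o Fin n) :=
  Fintype.ofEquiv _ Set.powersetCard.ofFinEmbEquiv.symm

theorem card_orderEmbedding (m n : ℕ) : Fintype.card (Fin m ↪o Fin n) = n.choose m := by
  rw [Fintype.card_congr Set.powersetCard.ofFinEmbEquiv, ← Nat.card_eq_fintype_card,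
    Set.powersetCard.card, Nat.card_eq_fintype_card, Fintype.card_fin]

/-- The set of indices used by an increasing `m`-tuple of indices. -/
def support (s : Fin m ↪o Fin n) : Finset (Fin n) := Finset.univ.map s.toEmbedding

theorem mem_support {s : Fin m ↪o Fin n} {i : Fin n} : i ∈ support s ↔ ∃ j, s j = i := by
  simp [support]

theorem apply_mem_support (s : Fin m ↪o Fin n) (j : Fin m) : s j ∈ support s :=
  mem_support.2 ⟨j, rfl⟩

theorem card_support (s : Fin m ↪o Fin n) : (support s).card = m := by simp [support]

theorem support_injective : Function.Injective (support (m := m) (n := n)) := by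
  intro s t h
  refine Set.powersetCard.ofFinEmbEquiv.injective (Subtype.ext ?_)
  simpa [Set.powersetCard.ofFinEmbEquiv_apply, support] using h

/-- Choose the union `T`, then two subsets of it: at most `2^j · 2^j` choices for each `T`. Only the
order `n^j` matters later. -/
theorem card_pairs_union_eq_le (m n j : ℕ) :
    (Finset.univ.filter fun st : (Fin m ↪o Fin n) × (Fin m ↪o Fin n) =>
      (support st.1 ∪ support st.2).card = j).card ≤ n.choose j * 4 ^ j := by
  classical
  calc _ ≤ ((Finset.powersetCard j (Finset.univ : Finset (Fin n))).biUnion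
        fun T => T.powerset ×ˢ T.powerset).card := by
        refine Finset.card_le_card_of_injOn (fun st => (support st.1, support st.2)) ?_ ?_
        · intro st hst
          simp only [Finset.coe_filter, Finset.mem_univ, true_and, Set.mem_ofPred_eq] at hst
          simp only [Finset.coe_biUnion, Set.mem_iUnion, Finset.mem_coe, Finset.mem_powersetCard,
            Finset.mem_product, Finset.mem_powerset]
          exact ⟨_, ⟨Finset.subset_univ _, hst⟩, Finset.subset_union_left,
            Finset.subset_union_right⟩
        · rintro ⟨s, t⟩ _ ⟨s', t'⟩ _ h
          simp only [Prod.mk.injEq] at h ⊢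
          exact ⟨support_injective h.1, support_injective h.2⟩
    _ ≤ ∑ T ∈ Finset.powersetCard j (Finset.univ : Finset (Fin n)),
          (T.powerset ×ˢ T.powerset).card := Finset.card_biUnion_le
    _ = ∑ T ∈ Finset.powersetCard j (Finset.univ : Finset (Fin n)), 4 ^ j := by
        refine Finset.sum_congr rfl fun T hT => ?_
        rw [Finset.card_product, Finset.card_powerset, (Finset.mem_powersetCard.1 hT).2,
          ← mul_pow]
        norm_num
    _ = _ := by simp

/-- The index tuples sharing an index with `s`. -/
def overlapping (s : Fin m ↪o Fin n) : Finset (Fin m ↪o Fin n) :=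
  open Classical in Finset.univ.filter fun t => ¬ Disjoint (support s) (support t)

theorem mem_overlapping {s t : Fin m ↪o Fin n} :
    t ∈ overlapping s ↔ ¬ Disjoint (support s) (support t) := by
  simp [overlapping]

theorem self_mem_overlapping (hm : 1 ≤ m) (s : Fin m ↪o Fin n) : s ∈ overlapping s := by
  rw [mem_overlapping, disjoint_self, Finset.bot_eq_empty, ← Finset.card_eq_zero, card_support]
  omega

theorem card_union_mem_Icc {s t : Fin m ↪o Fin n} (ht : t ∈ overlapping s) :
    (support s ∪ support t).card ∈ Finset.Icc m (2 * m - 1) := by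
  have h1 := Finset.card_union_add_card_inter (support s) (support t)
  have h2 : 0 < (support s ∩ support t).card := by
    rw [Finset.card_pos, ← Finset.not_disjoint_iff_nonempty_inter]
    exact mem_overlapping.1 ht
  have h3 := Finset.card_le_card (Finset.subset_union_left (s₁ := support s) (s₂ := support t))
  rw [card_support] at h3
  rw [card_support, card_support] at h1
  rw [Finset.mem_Icc]
  omega

theorem sum_overlapping_le {F : ℕ → ℝ} (hF : ∀ j, 0 ≤ F j) :
    ∑ s : Fin m ↪o Fin n, ∑ t ∈ overlapping s, F (support s ∪ support t).card
      ≤ ∑ j ∈ Finset.Icc m (2 * m - 1), (n.choose j * 4 ^ j : ℝ) * F j := by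
  classical
  rw [Finset.sum_sigma', ← Finset.sum_fiberwise_of_maps_to
    (g := fun x => (support x.1 ∪ support x.2).card) (t := Finset.Icc m (2 * m - 1))]
  · refine Finset.sum_le_sum fun j _ => ?_
    rw [Finset.sum_congr rfl (g := fun _ => F j)
      fun x hx => by rw [(Finset.mem_filter.1 hx).2], Finset.sum_const, nsmul_eq_mul]
    refine mul_le_mul_of_nonneg_right ?_ (hF j)
    refine le_trans ?_ (show ((_ : ℕ) : ℝ) ≤ (n.choose j * 4 ^ j : ℝ) from by
      exact_mod_cast card_pairs_union_eq_le m n j)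
    refine Nat.cast_le.2 (Finset.card_le_card_of_injOn (fun x => (x.1, x.2)) ?_ ?_)
    · intro x hx
      simp only [Finset.coe_filter, Set.mem_ofPred_eq] at hx
      simpa using hx.2
    · rintro ⟨s, t⟩ _ ⟨s', t'⟩ _ h
      simp only [Prod.mk.injEq] at h
      obtain ⟨rfl, rfl⟩ := h
      rfl
  · intro x hx
    exact card_union_mem_Icc (Finset.mem_sigma.1 hx).2

end PairCounting

/-! ### Poisson approximation for tuples of an i.i.d. sample -/

section Dissociated

variable {Ω α : Type*} [MeasurableSpace Ω] [MeasurableSpace α] {P : Measure Ω}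
  {X : ℕ → Ω → α} {m n : ℕ}

/-- The event that the tuple selected by `s` falls into `A`. -/
def tupleEvent (X : ℕ → Ω → α) (A : Set (Fin m → α)) (s : Fin m ↪o Fin n) : Set Ω :=
  {ω | (fun j => X (s j) ω) ∈ A}

theorem measurableSet_tupleEvent (hX : ∀ i, Measurable (X i)) {A : Set (Fin m → α)}
    (hA : MeasurableSet A) (s : Fin m ↪o Fin n) : MeasurableSet (tupleEvent X A s) :=
  (measurable_pi_lambda (fun ω (j : Fin m) => X (s j) ω) fun _ => hX _) hA

theorem measureReal_tupleEvent [IsProbabilityMeasure P] (hX : ∀ i, Measurable (X i))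
    (hind : iIndepFun X P) {μ : Measure α}
    (hlaw : ∀ i, P.map (X i) = μ) {A : Set (Fin m → α)}
    (hA : MeasurableSet A) (s : Fin m ↪o Fin n) :
    P.real (tupleEvent X A s) = (Measure.pi fun _ : Fin m => μ).real A := by
  have hinj : Function.Injective fun j : Fin m => ((s j : Fin n) : ℕ) :=
    Fin.val_injective.comp s.injective
  have h := hind.precomp hinj
  rw [iIndepFun_iff_map_fun_eq_pi_map fun j : Fin m => (hX (s j)).aemeasurable] at h
  simp only [hlaw] at h
  rw [← h, map_measureReal_apply (measurable_pi_lambda _ fun _ => hX _) hA]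
  rfl

theorem indepFun_tupleEvent (hX : ∀ i, Measurable (X i)) (hind : iIndepFun X P)
    {A : Set (Fin m → α)} (hA : MeasurableSet A) [DecidableEq (Fin m ↪o Fin n)]
    (s : Fin m ↪o Fin n) :
    IndepFun ((tupleEvent X A s).indicator fun _ => (1 : ℝ))
      (eventCount (tupleEvent X A) (overlapping s)ᶜ) P := by
  classical
  have hind' : iIndepFun (fun (i : Fin n) => X i) P := hind.precomp Fin.val_injective
  have hST := hind'.indepFun_finset (support s) (support s)ᶜ disjoint_compl_right fun i => hX i
  have hφ : Measurable fun v : support s → α =>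
      A.indicator (fun _ => (1 : ℝ)) fun j => v ⟨s j, apply_mem_support s j⟩ :=
    (measurable_const.indicator hA).comp (measurable_pi_lambda _ fun j => measurable_pi_apply _)
  -- The count must be a function of the variables outside `support s` only. The default `0` is
  -- never reached, since tuples not in `overlapping s` have all their indices there.
  have hψ : Measurable fun v : ((support s)ᶜ : Finset (Fin n)) → α =>
      ∑ t ∈ (overlapping s)ᶜ, if h : ∀ j, t j ∈ (support s)ᶜ then
        A.indicator (fun _ => (1 : ℕ)) fun j => v ⟨t j, h j⟩ else 0 := by
    refine Finset.measurable_fun_sum _ fun t _ => ?_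
    by_cases h : ∀ j, t j ∈ (support s)ᶜ
    · simp only [h, implies_true, dite_true]
      exact (measurable_const.indicator hA).comp
        (measurable_pi_lambda _ fun j => measurable_pi_apply _)
    · simp only [h, dite_false]
      exact measurable_const
  have := hST.comp hφ hψ
  refine (congrArg (fun W => IndepFun _ W P) ?_).mpr this
  funext ω
  simp only [Function.comp_apply, eventCount]
  refine Finset.sum_congr rfl fun t ht => ?_
  have h : ∀ j, t j ∈ (support s)ᶜ := by
    intro j
    rw [Finset.mem_compl, mem_overlapping, not_not] at ht
    rw [Finset.mem_compl]
    exact Finset.disjoint_right.1 ht (apply_mem_support t j)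
  rw [dif_pos h]
  rfl

/-- The relation `E` links every point of either tuple to the point at a shared index, so the other
indices of the union each cost a factor `q`; the shared one is free, whence the `- 1`. -/
theorem measureReal_inter_tupleEvent_le [IsProbabilityMeasure P] (hX : ∀ i, Measurable (X i))
    (hind : iIndepFun X P)
    {μ : Measure α} (hlaw : ∀ i, P.map (X i) = μ) {A : Set (Fin m → α)}
    {E : Set (α × α)} (hE : MeasurableSet E) (hAE : ∀ v ∈ A, ∀ i j, (v i, v j) ∈ E) {q : ℝ}
    (hq0 : 0 ≤ q) (hq : ∀ y, μ (Prod.mk y ⁻¹' E) ≤ ENNReal.ofReal q) {s t : Fin m ↪o Fin n}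
    (ht : t ∈ overlapping s) :
    P.real (tupleEvent X A s ∩ tupleEvent X A t) ≤ q ^ ((support s ∪ support t).card - 1) := by
  obtain ⟨i₀, hs₀, ht₀⟩ := Finset.not_disjoint_iff.1 (mem_overlapping.1 ht)
  have hmem : i₀ ∈ support s ∪ support t := Finset.mem_union_left _ hs₀
  have hind' : iIndepFun (fun (i : Fin n) => X i) P := hind.precomp Fin.val_injective
  have h := measure_forall_mem_le_pow (X := fun i : Fin n => X i) (fun i => hX i) hind'
    (fun i => hlaw i) hE hq (Finset.notMem_erase i₀ (support s ∪ support t))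
  rw [Finset.card_erase_of_mem hmem, ← ENNReal.ofReal_pow hq0] at h
  refine ENNReal.toReal_le_of_le_ofReal (by positivity) ((measure_mono ?_).trans h)
  rintro ω ⟨hωs, hωt⟩ i hi
  rcases Finset.mem_union.1 (Finset.mem_of_mem_erase hi) with hi' | hi'
  · obtain ⟨j₀, rfl⟩ := mem_support.1 hs₀
    obtain ⟨j, rfl⟩ := mem_support.1 hi'
    exact hAE _ hωs j₀ j
  · obtain ⟨j₀, rfl⟩ := mem_support.1 ht₀
    obtain ⟨j, rfl⟩ := mem_support.1 hi'
    exact hAE _ hωt j₀ j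

/-- Poisson approximation for the event that no `m`-tuple of an i.i.d. sample falls into `A`. -/
theorem abs_measureReal_no_tuple_sub_exp_le [IsProbabilityMeasure P] (hm : 1 ≤ m)
    (hX : ∀ i, Measurable (X i))
    (hind : iIndepFun X P) {μ : Measure α} (hlaw : ∀ i, P.map (X i) = μ) {A : Set (Fin m → α)}
    (hA : MeasurableSet A) {E : Set (α × α)} (hE : MeasurableSet E)
    (hAE : ∀ v ∈ A, ∀ i j, (v i, v j) ∈ E) {q : ℝ} (hq0 : 0 ≤ q)
    (hq : ∀ y, μ (Prod.mk y ⁻¹' E) ≤ ENNReal.ofReal q) (n : ℕ) :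
    |P.real (⋂ s : Fin m ↪o Fin n, (tupleEvent X A s)ᶜ)
        - Real.exp (-(n.choose m * (Measure.pi fun _ : Fin m => μ).real A))|
      ≤ ∑ j ∈ Finset.Icc m (2 * m - 1), (n.choose j * 4 ^ j : ℝ) *
          ((Measure.pi fun _ : Fin m => μ).real A ^ 2 + if j ≤ m then 0 else q ^ (j - 1)) := by
  classical
  set a := (Measure.pi fun _ : Fin m => μ).real A with ha
  have hp : ∀ s : Fin m ↪o Fin n, P.real (tupleEvent X A s) = a :=
    measureReal_tupleEvent hX hind hlaw hA
  have h := abs_measureReal_iInter_compl_sub_exp_le P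
    (A := fun s : Fin m ↪o Fin n => tupleEvent X A s)
    (measurableSet_tupleEvent hX hA) overlapping (self_mem_overlapping hm)
    (indepFun_tupleEvent hX hind hA)
  simp only [hp, Finset.sum_const, Finset.card_univ, card_orderEmbedding, nsmul_eq_mul] at h
  refine h.trans (le_trans (Finset.sum_le_sum fun s _ => ?_) (sum_overlapping_le
    (F := fun j => a ^ 2 + if j ≤ m then 0 else q ^ (j - 1)) fun j => by positivity))
  rw [Finset.sum_add_distrib]
  refine add_le_add (le_of_eq ?_) ?_
  · simp [sq]
  · refine le_trans (Finset.sum_le_sum (g := fun t => if (support s ∪ support t).card ≤ m then 0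
      else q ^ ((support s ∪ support t).card - 1)) fun t ht => ?_)
      (Finset.sum_le_sum_of_subset_of_nonneg (Finset.erase_subset _ _) fun t _ _ => ?_)
    · have hts := Finset.mem_erase.1 ht
      rw [if_neg]
      · exact measureReal_inter_tupleEvent_le hX hind hlaw hE hAE hq0 hq hts.2
      -- A union of only `m` indices would force the two supports, hence the two tuples, to
      -- coincide; so for distinct tuples the branch `0` never occurs.
      · intro hle
        have h1 : support s = support s ∪ support t :=
          Finset.eq_of_subset_of_card_le Finset.subset_union_left (by rwa [card_support])
        have h2 : support t = support s ∪ support t :=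
          Finset.eq_of_subset_of_card_le Finset.subset_union_right (by rwa [card_support])
        exact hts.1 (support_injective (h2.trans h1.symm))
    · positivity

end Dissociated

/-! ### Asymptotics at the critical scale -/

section Scaling

/-- The distance scale at which the `m`-gons, `m = k + 1`, of a sample of size `n` come close to
the regular polygon. -/
def polygonScale (k : ℕ) (t : ℝ) (n : ℕ) : ℝ :=
  Real.sqrt t * (n : ℝ) ^ (-(((k : ℝ) + 1) / k))

variable {k : ℕ} {t : ℝ}

theorem polygonScale_pos (ht : 0 < t) {n : ℕ} (hn : 1 ≤ n) : 0 < polygonScale k t n := by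
  have : (0 : ℝ) < n := by exact_mod_cast hn
  have := Real.sqrt_pos.2 ht
  unfold polygonScale
  positivity

theorem tendsto_polygonScale (hk : 1 ≤ k) (ht : 0 < t) :
    Tendsto (polygonScale k t) atTop (𝓝[>] 0) := by
  have hk0 : (0 : ℝ) < k := by exact_mod_cast hk
  refine tendsto_nhdsWithin_iff.2 ⟨?_, ?_⟩
  · have h := ((tendsto_rpow_neg_atTop (y := ((k : ℝ) + 1) / k) (by positivity)).comp
      tendsto_natCast_atTop_atTop).const_mul (Real.sqrt t)
    rw [mul_zero] at h
    exact h
  · filter_upwards [eventually_ge_atTop 1] with n hn using polygonScale_pos ht hn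

/-- The exponent is chosen for this: `ε^k` has order `n^(-(k+1))`, which balances the number of `(k
+ 1)`-tuples. -/
theorem polygonScale_pow (hk : 1 ≤ k) {n : ℕ} :
    polygonScale k t n ^ k = Real.sqrt t ^ k * ((n : ℝ) ^ (k + 1))⁻¹ := by
  have hk0 : (k : ℝ) ≠ 0 := by positivity
  have hn : (0 : ℝ) ≤ n := Nat.cast_nonneg n
  rw [polygonScale, mul_pow, ← Real.rpow_natCast (_ ^ _) k, ← Real.rpow_mul hn,
    ← Real.rpow_natCast _ (k + 1), ← Real.rpow_neg hn]
  congr 2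
  push_cast
  field_simp

theorem polygonScale_sq (ht : 0 < t) {n : ℕ} :
    polygonScale k t n ^ 2 = t / (n : ℝ) ^ (2 * ((k : ℝ) + 1) / k) := by
  have hn : (0 : ℝ) ≤ n := Nat.cast_nonneg n
  rw [polygonScale, mul_pow, Real.sq_sqrt ht.le, ← Real.rpow_natCast _ 2, ← Real.rpow_mul hn,
    div_eq_mul_inv t, ← Real.rpow_neg hn]
  congr 2
  push_cast
  ring

theorem tendsto_choose_mul_inv_pow (j : ℕ) :
    Tendsto (fun n : ℕ => (n.choose j : ℝ) * ((n : ℝ) ^ j)⁻¹) atTop (𝓝 (1 / j.factorial)) := by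
  have h1 : Tendsto (fun n : ℕ => (n : ℝ) * (n : ℝ)⁻¹) atTop (𝓝 1) := by
    refine tendsto_const_nhds.congr' ?_
    filter_upwards [eventually_ge_atTop 1] with n hn
    have : (n : ℝ) ≠ 0 := by positivity
    rw [mul_inv_cancel₀ this]
  simpa using tendsto_choose_mul_pow_atTop j h1

theorem tendsto_choose_mul_of_tendsto {m : ℕ} {a : ℕ → ℝ} {l : ℝ}
    (ha : Tendsto (fun n : ℕ => (n : ℝ) ^ m * a n) atTop (𝓝 l)) :
    Tendsto (fun n : ℕ => (n.choose m : ℝ) * a n) atTop (𝓝 (1 / m.factorial * l)) := by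
  refine ((tendsto_choose_mul_inv_pow m).mul ha).congr' ?_
  filter_upwards [eventually_ge_atTop 1] with n hn
  have : (n : ℝ) ≠ 0 := by positivity
  field_simp

/-- Overlapping pairs use at most `2m - 1` indices, while `a² = O(n^(-2m))`, so a factor `n^(j -
2m)` is left over. -/
theorem tendsto_choose_mul_sq {m j : ℕ} (hj : j < 2 * m) {a : ℕ → ℝ} {l : ℝ}
    (ha : Tendsto (fun n : ℕ => (n : ℝ) ^ m * a n) atTop (𝓝 l)) :
    Tendsto (fun n : ℕ => (n.choose j : ℝ) * a n ^ 2) atTop (𝓝 0) := by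
  have h0 : Tendsto (fun n : ℕ => ((n : ℝ)⁻¹) ^ (2 * m - j)) atTop (𝓝 0) := by
    have := (tendsto_inv_atTop_nhds_zero_nat (𝕜 := ℝ)).pow (2 * m - j)
    rwa [zero_pow (by omega)] at this
  have := ((tendsto_choose_mul_inv_pow j).mul (ha.pow 2)).mul h0
  rw [mul_zero] at this
  refine this.congr' ?_
  filter_upwards [eventually_ge_atTop 1] with n hn
  have hn0 : (n : ℝ) ≠ 0 := by positivity
  have e : (n : ℝ) ^ (2 * m) = (n : ℝ) ^ j * (n : ℝ) ^ (2 * m - j) := by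
    rw [← pow_add]; congr 1; omega
  calc _ = (n.choose j : ℝ) * a n ^ 2 *
        ((n : ℝ) ^ (2 * m) * ((n : ℝ) ^ j * (n : ℝ) ^ (2 * m - j))⁻¹) := by
        rw [inv_pow, mul_inv, mul_pow, ← pow_mul, mul_comm m 2]; ring
    _ = _ := by rw [← e, mul_inv_cancel₀ (by positivity), mul_one]

/-- The total power of `n` is `j - (j - 1)(k + 1)/k = -(j - (k + 1))/k`, negative exactly when `j >
k + 1`. -/
theorem tendsto_choose_mul_scale_pow (hk : 1 ≤ k) {j : ℕ} (hj : k + 1 < j) (D : ℝ) :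
    Tendsto (fun n : ℕ => (n.choose j : ℝ) * (D * polygonScale k t n) ^ (j - 1)) atTop
      (𝓝 0) := by
  have hk0 : (0 : ℝ) < k := by exact_mod_cast hk
  have hj' : (k : ℝ) + 1 < j := by exact_mod_cast hj
  have h0 := (tendsto_rpow_neg_atTop (y := ((j : ℝ) - (k + 1)) / k)
    (div_pos (by linarith) hk0)).comp (tendsto_natCast_atTop_atTop (R := ℝ))
  have := ((tendsto_choose_mul_inv_pow j).mul_const ((D * Real.sqrt t) ^ (j - 1))).mul h0
  rw [mul_zero] at this
  refine this.congr' ?_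
  filter_upwards [eventually_ge_atTop 1] with n hn
  have hn0 : (0 : ℝ) < n := by positivity
  have e : ((n : ℝ) ^ j)⁻¹ * (n : ℝ) ^ (-(((j : ℝ) - (k + 1)) / k))
      = ((n : ℝ) ^ (-(((k : ℝ) + 1) / k))) ^ (j - 1) := by
    rw [← Real.rpow_natCast _ (j - 1), ← Real.rpow_natCast _ j, ← Real.rpow_neg hn0.le,
      ← Real.rpow_mul hn0.le, ← Real.rpow_add hn0, Nat.cast_sub (by omega)]
    congr 1
    push_cast
    field_simp
    ring
  rw [polygonScale, ← mul_assoc, mul_pow _ (_ ^ _), ← e]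
  simp only [Function.comp_apply]
  ring

end Scaling

/-! ### Combining the estimates -/

section Assembly

variable {Ω : Type*} [MeasurableSpace Ω] {P : Measure Ω} [IsProbabilityMeasure P] {k : ℕ}
  {g p : ℝ → ℝ} {U : ℕ → Ω → Circle}

/-- The configurations whose kernel is within `e ^ 2` of the maximum. -/
def nearMax (g : ℝ → ℝ) (k : ℕ) (e : ℝ) : Set (Fin (k + 1) → Circle) :=
  {V | (k + 1 : ℕ) * g (regArc (k + 1)) - e ^ 2 ≤ arcKernel g V}

theorem le_uMax_iff {α : Type*} {m n : ℕ} (hmn : m ≤ n) (f : (Fin m → α) → ℝ) (u : ℕ → α)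
    (L : ℝ) : L ≤ uMax f n u ↔ ∃ s : Fin m ↪o Fin n, L ≤ f fun j => u (s j) := by
  have : Nonempty (Fin m ↪o Fin n) := ⟨Fin.castLEOrderEmb hmn⟩
  unfold uMax
  constructor
  · intro h
    obtain ⟨s, hs⟩ := exists_eq_ciSup_of_finite (f := fun s : Fin m ↪o Fin n => f fun j => u (s j))
    exact ⟨s, hs ▸ h⟩
  · rintro ⟨s, hs⟩
    exact hs.trans (le_ciSup (f := fun s : Fin m ↪o Fin n => f fun j => u (s j))
      (Set.finite_range _).bddAbove s)

/-- For `n ≥ k + 1` the maximum runs over a nonempty finite set and is attained, so a small deficit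
means that some tuple is near-maximal; `polygonScale` squared is exactly `t` over the normalising
power of `n`. -/
theorem setOf_scaled_deficit_le {Ω : Type*} {U : ℕ → Ω → Circle} {n : ℕ} (hn : k + 1 ≤ n)
    {t : ℝ} (ht : 0 < t) :
    {ω | (n : ℝ) ^ (2 * ((k + 1 : ℕ) : ℝ) / (((k + 1 : ℕ) : ℝ) - 1)) *
        (((k + 1 : ℕ) : ℝ) * g (2 * Real.pi / ((k + 1 : ℕ) : ℝ)) -
          uMax (arcKernel (m := k + 1) g) n (fun i => U i ω)) ≤ t}
      = (⋂ s : Fin (k + 1) ↪o Fin n,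
          (tupleEvent U (nearMax g k (polygonScale k t n)) s)ᶜ)ᶜ := by
  have hn0 : (0 : ℝ) < n := by exact_mod_cast (by omega : 0 < n)
  ext ω
  simp only [Set.compl_iInter, compl_compl, Set.mem_iUnion, tupleEvent, nearMax, Set.mem_ofPred_eq]
  rw [← le_uMax_iff hn (arcKernel (m := k + 1) g) (fun i => U i ω), polygonScale_sq ht,
    ← le_div_iff₀' (by positivity)]
  have e : 2 * ((k + 1 : ℕ) : ℝ) / (((k + 1 : ℕ) : ℝ) - 1) = 2 * ((k : ℝ) + 1) / k := by
    push_cast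
    ring
  rw [e, regArc]
  constructor <;> intro h <;> linarith

theorem tendsto_measureReal_no_near_max (hk : 1 ≤ k)
    (hg : ContinuousOn g (Set.Icc 0 (2 * Real.pi))) (hmax : OnlyRegularMax g k)
    (hs : ContDiffAt ℝ 3 g (regArc (k + 1))) (h2 : iteratedDeriv 2 g (regArc (k + 1)) ≠ 0)
    (hp : Continuous p) (hp0 : ∀ x, 0 ≤ p x) (hper : Function.Periodic p (2 * Real.pi))
    (hU : ∀ i, Measurable (U i)) (hind : iIndepFun U P) (hlaw : ∀ i, P.map (U i) = circleLaw p)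
    {t : ℝ} (ht : 0 < t) :
    Tendsto (fun n : ℕ => P.real (⋂ s : Fin (k + 1) ↪o Fin n,
        (tupleEvent U (nearMax g k (polygonScale k t n)) s)ᶜ)) atTop
      (𝓝 (Real.exp (-(Real.sqrt t ^ k * localConst g p k / ((k + 1 : ℕ) : ℝ))))) := by
  have hprob : IsProbabilityMeasure (circleLaw p) :=
    hlaw 0 ▸ Measure.isProbabilityMeasure_map (hU 0).aemeasurable
  obtain ⟨C, hC, hCb⟩ := exists_norm_pow_sub_pow_le hk hg hmax hs h2
  obtain ⟨B, hB, hBb⟩ := exists_circleLaw_near_le hp (k + 1)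
  set e := polygonScale k t with he
  set a : ℕ → ℝ := fun n =>
    (Measure.pi fun _ : Fin (k + 1) => circleLaw p).real (nearMax g k (e n)) with ha
  have hlim : Tendsto (fun n : ℕ => (n : ℝ) ^ (k + 1) * a n) atTop
      (𝓝 (Real.sqrt t ^ k * (k.factorial * localConst g p k))) := by
    have h := ((tendsto_measureReal_le_arcKernel_div hk hg hmax hs h2 hp hp0 hper).comp
      (tendsto_polygonScale hk ht)).const_mul (Real.sqrt t ^ k)
    refine h.congr' ?_
    filter_upwards [eventually_ge_atTop 1] with n hn
    have hn0 : (n : ℝ) ≠ 0 := by positivity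
    have ht0 : Real.sqrt t ≠ 0 := (Real.sqrt_pos.2 ht).ne'
    simp only [Function.comp_apply, polygonScale_pow hk]
    rw [ha]
    simp only [nearMax, he]
    field_simp
  -- The mean number of near-maximal tuples: the `k!` from ordering the angles against the `(k +
  -- 1)!` of the binomial coefficient leaves the denominator `m`.
  have hlam : Tendsto (fun n : ℕ => (n.choose (k + 1) : ℝ) * a n) atTop
      (𝓝 (Real.sqrt t ^ k * localConst g p k / ((k + 1 : ℕ) : ℝ))) := by
    convert tendsto_choose_mul_of_tendsto hlim using 2
    rw [Nat.factorial_succ, Nat.cast_mul]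
    have : (k.factorial : ℝ) ≠ 0 := by exact_mod_cast k.factorial_ne_zero
    field_simp
  have herr : Tendsto (fun n : ℕ => ∑ j ∈ Finset.Icc (k + 1) (2 * (k + 1) - 1),
      (n.choose j * 4 ^ j : ℝ) * (a n ^ 2 + if j ≤ k + 1 then 0 else (B * (C * e n)) ^ (j - 1)))
      atTop (𝓝 0) := by
    suffices h : ∀ j ∈ Finset.Icc (k + 1) (2 * (k + 1) - 1), Tendsto (fun n : ℕ =>
        (n.choose j * 4 ^ j : ℝ) * (a n ^ 2 + if j ≤ k + 1 then 0 else
          (B * (C * e n)) ^ (j - 1))) atTop (𝓝 0) by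
      simpa using tendsto_finsetSum _ h
    intro j hj
    rw [Finset.mem_Icc] at hj
    have h1 := (tendsto_choose_mul_sq (j := j) (by omega) hlim).const_mul ((4 : ℝ) ^ j)
    by_cases hle : j ≤ k + 1
    · simp only [hle, if_true, add_zero]
      rw [mul_zero] at h1
      exact h1.congr fun n => by ring
    · simp only [hle, if_false]
      have h3 := (tendsto_choose_mul_scale_pow (t := t) hk (not_le.1 hle) (B * C)).const_mul
        ((4 : ℝ) ^ j)
      have := h1.add h3
      rw [mul_zero, add_zero] at this
      refine this.congr fun n => ?_
      rw [he, ← mul_assoc B C]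
      ring
  have hexp : Tendsto (fun n : ℕ => Real.exp (-((n.choose (k + 1) : ℝ) * a n))) atTop
      (𝓝 (Real.exp (-(Real.sqrt t ^ k * localConst g p k / ((k + 1 : ℕ) : ℝ))))) :=
    (Real.continuous_exp.tendsto _).comp hlam.neg
  have hdiff : Tendsto (fun n : ℕ => P.real (⋂ s : Fin (k + 1) ↪o Fin n,
      (tupleEvent U (nearMax g k (e n)) s)ᶜ) - Real.exp (-((n.choose (k + 1) : ℝ) * a n))) atTop
      (𝓝 0) := by
    refine squeeze_zero_norm' ?_ herr
    filter_upwards [eventually_ge_atTop 1] with n hn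
    have hen : 0 < e n := polygonScale_pos ht hn
    refine abs_measureReal_no_tuple_sub_exp_le (by omega) hU hind hlaw
      (E := {yz : Circle × Circle | ‖(yz.2 : ℂ) ^ (k + 1) - (yz.1 : ℂ) ^ (k + 1)‖ ≤ C * e n})
      (measurableSet_le measurable_const (measurable_arcKernel hg)) ?_ ?_ (by positivity) ?_ n
    · exact (isClosed_le (by fun_prop) continuous_const).measurableSet
    · intro V hV i j
      have := hCb (e n ^ 2) (by positivity) V hV j i
      rwa [Real.sqrt_sq hen.le] at this
    · intro y
      exact hBb y (C * e n) (by positivity)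
  have := hdiff.add hexp
  rw [zero_add] at this
  exact this.congr fun n => sub_add_cancel _ _

end Assembly

end CirclePolygon

end

/-! ### The limit law -/

theorem theorem5p1 {Ω : Type*} [MeasurableSpace Ω] (P : Measure Ω) [IsProbabilityMeasure P]
    (m : ℕ) [NeZero m] (hm : 2 ≤ m)
    (g : ℝ → ℝ)
    (hg_cont : ContinuousOn g (Set.Icc 0 (2 * Real.pi)))
    (hg_smooth : ContDiffAt ℝ 3 g (2 * Real.pi / (m : ℝ)))
    (hg_second : iteratedDeriv 2 g (2 * Real.pi / (m : ℝ)) ≠ 0)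
    (hmax : ∀ V : Fin m → Circle,
      (∀ W : Fin m → Circle, CirclePolygon.arcKernel g W ≤ CirclePolygon.arcKernel g V) →
        CirclePolygon.IsRegularPolygon V)
    (p : ℝ → ℝ) (hp_cont : Continuous p) (hp_nonneg : ∀ x, 0 ≤ p x)
    (hp_per : Function.Periodic p (2 * Real.pi))
    (hp_overlap : 0 < CirclePolygon.regularOverlap p m)
    (U : ℕ → Ω → Circle) (hU_meas : ∀ i, Measurable (U i))
    (hU_indep : iIndepFun U P)
    (hU_law : ∀ i, P.map (U i) = CirclePolygon.circleLaw p)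
    (t : ℝ) (ht : 0 < t) :
    Tendsto
      (fun n : ℕ => P.real {ω |
        (n : ℝ) ^ (2 * (m : ℝ) / ((m : ℝ) - 1)) *
          ((m : ℝ) * g (2 * Real.pi / (m : ℝ)) -
            CirclePolygon.uMax (CirclePolygon.arcKernel (m := m) g) n (fun i => U i ω)) ≤ t})
      atTop
      (𝓝 (1 - Real.exp
        (-(t ^ (((m : ℝ) - 1) / 2) * CirclePolygon.limitConst g p m / (m : ℝ))))) := by
  obtain ⟨k, rfl⟩ : ∃ k, m = k + 1 := ⟨m - 1, by omega⟩
  have hk : 1 ≤ k := by omega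
  have hlim := CirclePolygon.tendsto_measureReal_no_near_max hk hg_cont hmax hg_smooth hg_second
    hp_cont hp_nonneg hp_per hU_meas hU_indep hU_law ht
  have hneg := CirclePolygon.iteratedDeriv_two_neg hk hg_cont hmax hg_smooth hg_second
  have ht' : t ^ ((((k + 1 : ℕ) : ℝ) - 1) / 2) = Real.sqrt t ^ k := by
    rw [Real.sqrt_eq_rpow, ← Real.rpow_natCast, ← Real.rpow_mul ht.le]
    congr 1
    push_cast
    ring
  rw [ht', ← CirclePolygon.localConst_eq_limitConst p hneg]
  refine (hlim.const_sub 1).congr' ?_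
  filter_upwards [eventually_ge_atTop (k + 1)] with n hn
  have hmeas : MeasurableSet (⋂ s : Fin (k + 1) ↪o Fin n, (CirclePolygon.tupleEvent U
      (CirclePolygon.nearMax g k (CirclePolygon.polygonScale k t n)) s)ᶜ) :=
    MeasurableSet.iInter fun s => (CirclePolygon.measurableSet_tupleEvent hU_meas
      (measurableSet_le measurable_const (CirclePolygon.measurable_arcKernel hg_cont)) s).compl
  rw [← probReal_compl_eq_one_sub hmeas, ← CirclePolygon.setOf_scaled_deficit_le hn ht]
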